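/- **Setting.** A base station has $N_t$ antennas and $N_{\mathrm{RF}}$ RF chains; antenna $a$ is connected to exactly one chain $m_a$, and the antennas are thereby partitioned into $N_{\mathrm{RF}}$ (nonempty) subarrays of identical size. There are $S$ subcarriers $s=0,\dots,S-1$ and $K$ users; $\ell$ is the oversampling factor and $N_{\mathrm{CP}}$ the cyclic prefix length. The RF precoder $\mathbf V_{\mathrm{RF}}\in\mathbb C^{N_t\times N_{\mathrm{RF}}}$ has $\mathbf V_{\mathrm{RF}}[a,m_a]=e^{\jmath\varphi_a}$ and zeros elsewhere. For fixed combiners $\mathbf U_k^s$, $\mathbf U_{\mathrm{RF},k}$ (the latter with unit-modulus entries on a given support and zeros elsewhere), channels $\mathbf H_k^s$ and symbols $\boldsymbol\omega_k^s$, put $\mathbf B_k^s=(\mathbf U_k^s)^H\mathbf U_{\mathrm{RF},k}^H\mathbf H_k^s\mathbf V_{\mathrm{RF}}$. Let $\mathbf F_{\ell S}^H\in\mathbb C^{\ell S\times S}$ have entries $\frac1{\sqrt{\ell S}}e^{\jmath2\pi ns/(\ell S)}$, and let $\mathbf A_n\in\mathbb C^{G\times S}$ be the spectral sampling matrix at the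 mask locations $\gamma_1,\dots,\gamma_G\in\mathbb R$: with $\delta=(\gamma_j-s)/(\ell S)$, $$\mathbf A_n[j,s]=\tfrac{1}{\sqrt{\ell S}}\,e^{\jmath\pi\delta(\ell N_{\mathrm{CP}}-\ell S+1)}\,\frac{\sin(\pi\delta(\ell S+\ell N_{\mathrm{CP}}))}{\sin(\pi\delta)}\ \text{ if }\delta\notin\mathbb Z,\qquad \mathbf A_n[j,s]=\tfrac{\ell S+\ell N_{\mathrm{CP}}}{\sqrt{\ell S}}\ \text{ if }\delta\in\mathbb Z .$$ For $\mathbf W\in\mathbb C^{N_t\times S}$ and $\mathbf T\in\mathbb C^{N_{\mathrm{RF}}\times S}$ let $\mathfrak A(\mathbf W)=\mathbf W\mathbf A_n^T$, $\mathfrak F(\mathbf W)=\mathbf W(\mathbf F_{\ell S}^H)^T$, $\mathfrak S(\mathbf T)[a,:]=\mathbf T[m_a,:]$. Let $r_j>0$, $\chi>0$, $P^s>0$, and let $\mathcal M=\{\mathbf Q\in\mathbb C^{N_t\times G}:|\mathbf Q[a,j]|^2\le r_j\}$, $\mathcal C=\{\mathbf X\in\mathbb C^{N_t\times\ell S}:|\mathbf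 X[a,n]|\le\chi\}$, $\mathcal P=\{\mathbf T:\frac{N_t}{N_{\mathrm{RF}}}\|\mathbf T[:,s]\|_2^2\le P^s\ \forall s\}$, with indicator functions $\delta_{\mathcal M},\delta_{\mathcal C},\delta_{\mathcal P}$ ($0$ on the set, $+\infty$ off it). The regularized inner problem with parameters $(\eta_w,\eta_t)$ is $$\min\ \theta_1(\mathbf Q)+\theta_2(\mathbf X)+\theta_3(\mathbf W)+\theta_4(\mathbf T)\quad\text{s.t.}\quad \mathbf Q=\mathfrak A(\mathbf W),\ \mathbf X=\mathfrak F(\mathbf W),\ \mathbf W=\mathfrak S(\mathbf T),\tag{1}$$ where $\theta_1=\delta_{\mathcal M}$, $\theta_2=\delta_{\mathcal C}$, $\theta_3(\mathbf W)=\frac{\eta_w}2\|\mathbf W\|_F^2$, $\theta_4(\mathbf T)=\sum_{s,k}\|\mathbf B_k^s\mathbf T[:,s]-\boldsymbol\omega_k^s\|_2^2+\delta_{\mathcal P}(\mathbf T)+\frac{\eta_t}2\|\mathbf T\|_F^2$; the unregularized inner problem is (1) with $\eta_w=\eta_t=0$. With $\langle\mathbf A,\mathbf B\rangle=\Re\operatorname{tr}(\mathbf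 A^H\mathbf B)$ and multipliers $\boldsymbol\Lambda_q,\boldsymbol\Lambda_x,\boldsymbol\Lambda_w$ of the three constraints, the augmented Lagrangian with penalty $\rho$ is the objective plus $\langle\boldsymbol\Lambda_q,\mathbf Q-\mathfrak A(\mathbf W)\rangle+\langle\boldsymbol\Lambda_x,\mathbf X-\mathfrak F(\mathbf W)\rangle+\langle\boldsymbol\Lambda_w,\mathbf W-\mathfrak S(\mathbf T)\rangle+\frac\rho2(\|\mathbf Q-\mathfrak A(\mathbf W)\|_F^2+\|\mathbf X-\mathfrak F(\mathbf W)\|_F^2+\|\mathbf W-\mathfrak S(\mathbf T)\|_F^2)$; for $\rho=0$ it is the Lagrangian. The cyclic ADMM minimizes the augmented Lagrangian successively over $\mathbf Q$, $\mathbf X$, $\mathbf W$, $\mathbf T$ (latest values for the other variables, dropping the terms $\theta_i$ of the blocks held fixed), then updates $\boldsymbol\Lambda_q\leftarrow\boldsymbol\Lambda_q+\rho(\mathbf Q-\mathfrak A(\mathbf W))$, $\boldsymbol\Lambda_x\leftarrow\boldsymbol\Lambda_x+\rho(\mathbf X-\mathfrak F(\mathbf W))$, $\boldsymbol\Lambda_w\leftarrow\boldsymbol\Lambda_w+\rho(\mathbf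 W-\mathfrak S(\mathbf T))$. **Proposition.** (a) Let $\mathcal R(\mathbf Z)=\begin{bmatrix}\Re\operatorname{vec}\mathbf Z\\ \Im\operatorname{vec}\mathbf Z\end{bmatrix}$, and let $\mathbf P\in\{0,1\}^{N_t\times N_{\mathrm{RF}}}$ have $\mathbf P[a,m]=1$ iff $m=m_a$. There are unique real matrices $\mathbf A_{\mathcal R},\mathbf F_{\mathcal R}$ with $\mathcal R(\mathfrak A(\mathbf W))=\mathbf A_{\mathcal R}\mathcal R(\mathbf W)$ and $\mathcal R(\mathfrak F(\mathbf W))=\mathbf F_{\mathcal R}\mathcal R(\mathbf W)$ for all $\mathbf W$; and, for all $\mathbf T$, $\mathfrak S(\mathbf T)=\mathbf P\mathbf T$, $\operatorname{vec}\mathfrak S(\mathbf T)=(\mathbf I_S\otimes\mathbf P)\operatorname{vec}\mathbf T$ and $\mathcal R(\mathfrak S(\mathbf T))=\mathbf S_{\mathcal R}\mathcal R(\mathbf T)$ with $\mathbf S_{\mathcal R}=\begin{bmatrix}\mathbf I_S\otimes\mathbf P&\mathbf 0\\ \mathbf 0&\mathbf I_S\otimes\mathbf P\end{bmatrix}$.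 (b) Let $\eta_w>0$, $\eta_t>0$ and $\rho>0$ (in particular, $\rho$ may be any penalty parameter that satisfies the step-size condition (3.37) of Tao and Yuan (2018) for the real-valued form of (1) obtained through $\mathcal R$). From every initial point the ADMM iterates exist and are unique, and they converge, primal and dual variables alike, to a primal--dual solution of (1), i.e. a saddle point of its Lagrangian. The primal limit $(\mathbf Q^\star,\mathbf X^\star,\mathbf W^\star,\mathbf T^\star)$ is a global optimal solution of (1) and satisfies, with the limit multipliers, the KKT conditions of (1): the equality constraints hold, $-\boldsymbol\Lambda_q^\star\in\partial\theta_1(\mathbf Q^\star)$, $-\boldsymbol\Lambda_x^\star\in\partial\theta_2(\mathbf X^\star)$, $\mathfrak A^*(\boldsymbol\Lambda_q^\star)+\mathfrak F^*(\boldsymbol\Lambda_x^\star)-\boldsymbol\Lambda_w^\star\in\partial\theta_3(\mathbf W^\star)$ and $\mathfrak S^*(\boldsymbol\Lambda_w^\star)\in\partial\theta_4(\mathbf T^\star)$, where adjoints and subdifferentials are taken for $\langle\cdot,\cdot\rangle$. (c) If $(\eta_w^\nu,\eta_t^\nu)\to(0,0)$ with $\eta_w^\nu,\eta_t^\nu>0$,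 and $(\mathbf Q^\nu,\mathbf X^\nu,\mathbf W^\nu,\mathbf T^\nu)$ is a global optimal solution of (1) with parameters $(\eta_w^\nu,\eta_t^\nu)$ for every $\nu$, then every accumulation point of this sequence is a global optimal solution of the unregularized inner problem. -/

import Mathlib

open Filter Topology Matrix
open scoped Kronecker

noncomputable section

/-! ### The transmitter model and the fixed data of the inner problem -/

/-- The data of a partially connected MU-MIMO-OFDM hybrid precoding system, for one realization of
the transmitted symbols and for fixed RF precoder and fixed combiners. -/
structure HybridSystem where
  /-- number of transmit antennas -/
  Nt : ℕ
  /-- number of RF chains -/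
  NRF : ℕ
  /-- number of subcarriers, indexed by `0, …, S - 1` -/
  S : ℕ
  /-- oversampling factor -/
  ell : ℕ
  /-- cyclic prefix length -/
  NCP : ℕ
  /-- number of spectral mask points -/
  G : ℕ
  /-- number of users -/
  K : ℕ
  /-- number of receive antennas of each user -/
  Nr : ℕ
  /-- number of RF chains of user `k` -/
  NRFr : Fin K → ℕ
  /-- number of streams of user `k` -/
  nStr : Fin K → ℕ
  /-- `conn a` is the RF chain `m_a` to which antenna `a` is connected -/
  conn : Fin Nt → Fin NRF
  /-- phase applied at antenna `a` -/
  phase : Fin Nt → ℝ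
  /-- channel matrix of user `k` on subcarrier `s` -/
  H : (k : Fin K) → Fin S → Matrix (Fin Nr) (Fin Nt) ℂ
  /-- feasible nonzero entries of the analog combiner of user `k` -/
  E : (k : Fin K) → Finset (Fin Nr × Fin (NRFr k))
  /-- phases of the analog combiner of user `k` -/
  rxPhase : (k : Fin K) → Fin Nr → Fin (NRFr k) → ℝ
  /-- digital combiner of user `k` on subcarrier `s` -/
  U : (k : Fin K) → Fin S → Matrix (Fin (NRFr k)) (Fin (nStr k)) ℂ
  /-- symbol vector of user `k` on subcarrier `s` -/
  sym : (k : Fin K) → Fin S → Fin (nStr k) → ℂ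
  /-- mask frequencies, in DFT-bin units on the `ell * S` grid -/
  gam : Fin G → ℝ
  /-- mask levels -/
  r : Fin G → ℝ
  /-- clipping level -/
  chi : ℝ
  /-- power budget on each subcarrier -/
  P : Fin S → ℝ

namespace HybridSystem

variable (sys : HybridSystem)

/-- The antennas are partitioned into `NRF` (nonempty) subarrays of identical size. -/
def EqualSubarrays : Prop :=
  ∃ d : ℕ, 0 < d ∧
    ∀ m : Fin sys.NRF, (Finset.univ.filter fun a : Fin sys.Nt => sys.conn a = m).card = d

/-- The RF precoder: row `a` has the single nonzero entry `exp (j φ_a)`, in column `conn a`. -/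
def VRF : Matrix (Fin sys.Nt) (Fin sys.NRF) ℂ :=
  Matrix.of fun a m => if m = sys.conn a then Complex.exp (Complex.I * (sys.phase a : ℂ)) else 0

/-- The analog combiner of user `k`. -/
def URF (k : Fin sys.K) : Matrix (Fin sys.Nr) (Fin (sys.NRFr k)) ℂ :=
  Matrix.of fun a m =>
    if (a, m) ∈ sys.E k then Complex.exp (Complex.I * (sys.rxPhase k a m : ℂ)) else 0

/-- The effective matrix `B_k^s = U_k^sᴴ U_{RF,k}ᴴ H_k^s V_RF`. -/
def B (k : Fin sys.K) (s : Fin sys.S) : Matrix (Fin (sys.nStr k)) (Fin sys.NRF) ℂ :=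
  (sys.U k s)ᴴ * (sys.URF k)ᴴ * sys.H k s * sys.VRF

/-- The oversampled IDFT matrix `F_{ℓS}ᴴ`. -/
def idft : Matrix (Fin (sys.ell * sys.S)) (Fin sys.S) ℂ :=
  Matrix.of fun n s =>
    ((1 / Real.sqrt ((sys.ell : ℝ) * sys.S) : ℝ) : ℂ) *
      Complex.exp (Complex.I * ((2 * Real.pi * ((n : ℕ) * (s : ℕ)) / (sys.ell * sys.S) : ℝ) : ℂ))

open Classical in
/-- The spectral sampling matrix `A_n` of the rectangular cyclic-prefix-inclusive pulse at the mask
frequencies. -/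
def maskMat : Matrix (Fin sys.G) (Fin sys.S) ℂ :=
  Matrix.of fun j s =>
    let N : ℝ := (sys.ell : ℝ) * sys.S
    let C : ℝ := (sys.ell : ℝ) * sys.NCP
    let d : ℝ := sys.gam j - (s : ℕ)
    if ∃ z : ℤ, d = N * z then (((N + C) / Real.sqrt N : ℝ) : ℂ)
    else
      ((1 / Real.sqrt N : ℝ) : ℂ) *
        Complex.exp (Complex.I * ((Real.pi * (d / N) * (C - N + 1) : ℝ) : ℂ)) *
        ((Real.sin (Real.pi * (d / N) * (N + C)) / Real.sin (Real.pi * (d / N)) : ℝ) : ℂ)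

/-! ### Variables, linear operators and objective terms -/

/-- Values of `Q`. -/
abbrev QMat := Matrix (Fin sys.Nt) (Fin sys.G) ℂ
/-- Values of `X`. -/
abbrev XMat := Matrix (Fin sys.Nt) (Fin (sys.ell * sys.S)) ℂ
/-- Values of `W`. -/
abbrev WMat := Matrix (Fin sys.Nt) (Fin sys.S) ℂ
/-- Values of `T`. -/
abbrev TMat := Matrix (Fin sys.NRF) (Fin sys.S) ℂ

/-- The primal variables. -/
@[ext] structure Primal where
  Q : sys.QMat
  X : sys.XMat
  W : sys.WMat
  T : sys.TMat

/-- The dual variables. -/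
@[ext] structure Dual where
  q : sys.QMat
  x : sys.XMat
  w : sys.WMat

/-- The operator `W ↦ W A_nᵀ`. -/
def opA (W : sys.WMat) : sys.QMat := W * sys.maskMatᵀ

/-- The operator `W ↦ W (F_{ℓS}ᴴ)ᵀ`. -/
def opF (W : sys.WMat) : sys.XMat := W * sys.idftᵀ

/-- The operator `T ↦ 𝔖(T)`, whose row `a` is row `conn a` of `T`. -/
def opS (T : sys.TMat) : sys.WMat := Matrix.of fun a s => T (sys.conn a) s

/-- The 0-1 selection matrix `P` of the antenna-to-chain connections, over a given ring. -/
def selMat (R : Type) [Zero R] [One R] : Matrix (Fin sys.Nt) (Fin sys.NRF) R :=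
  Matrix.of fun a m => if m = sys.conn a then 1 else 0

end HybridSystem

/-- The real inner product `Re tr(Aᴴ B)` of complex matrices. -/
def reInner {m n : ℕ} (A B : Matrix (Fin m) (Fin n) ℂ) : ℝ := (Matrix.trace (Aᴴ * B)).re

/-- The squared Frobenius norm. -/
def frobSq {m n : ℕ} (A : Matrix (Fin m) (Fin n) ℂ) : ℝ := ∑ i, ∑ j, ‖A i j‖ ^ 2

open Classical in
/-- The indicator function of a set: `0` on the set and `+∞` off it. -/
def setIndicator {α : Type} (Z : Set α) (z : α) : EReal := if z ∈ Z then 0 else ⊤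

/-- `x` minimizes the extended-valued function `f`, with a finite value (`f` is never `-∞` in what
follows). -/
def IsArgmin {α : Type} (f : α → EReal) (x : α) : Prop := f x < ⊤ ∧ ∀ y, f x ≤ f y

/-- `g` is a subgradient at `x` of the extended-valued function `f`, for the real inner product
`Re tr(Aᴴ B)`. -/
def IsSubgradient {m n : ℕ} (f : Matrix (Fin m) (Fin n) ℂ → EReal)
    (g x : Matrix (Fin m) (Fin n) ℂ) : Prop :=
  f x < ⊤ ∧ ∀ y, f x + ((reInner g (y - x) : ℝ) : EReal) ≤ f y

/-- The stacking `ℛ(Z) = [Re vec Z; Im vec Z]`, where `vec` stacks columns. -/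
def realify {m n : ℕ} (Z : Matrix (Fin m) (Fin n) ℂ) : (Fin n × Fin m) ⊕ (Fin n × Fin m) → ℝ :=
  Sum.elim (fun p => (Z.vec p).re) (fun p => (Z.vec p).im)

namespace HybridSystem

variable (sys : HybridSystem)

/-- The mask set `ℳ`. -/
def maskSet : Set sys.QMat := {Q | ∀ a j, ‖Q a j‖ ^ 2 ≤ sys.r j}

/-- The clipping set `𝒞`. -/
def clipSet : Set sys.XMat := {X | ∀ a n, ‖X a n‖ ≤ sys.chi}

/-- The power set `𝒫`. -/
def powerSet : Set sys.TMat :=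
  {T | ∀ s, (sys.Nt : ℝ) / (sys.NRF : ℝ) * (∑ m, ‖T m s‖ ^ 2) ≤ sys.P s}

/-- The data-fit term `∑_s ∑_k ‖B_k^s T[:,s] - ω_k^s‖²`. -/
def fit (T : sys.TMat) : ℝ :=
  ∑ s, ∑ k, ∑ i, ‖(sys.B k s *ᵥ (fun m => T m s)) i - sys.sym k s i‖ ^ 2

/-- `θ₁`. -/
def theta1 (Q : sys.QMat) : EReal := setIndicator sys.maskSet Q

/-- `θ₂`. -/
def theta2 (X : sys.XMat) : EReal := setIndicator sys.clipSet X

/-- `θ₃`. -/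
def theta3 (etaW : ℝ) (W : sys.WMat) : EReal := ((etaW / 2 * frobSq W : ℝ) : EReal)

/-- `θ₄`. -/
def theta4 (etaT : ℝ) (T : sys.TMat) : EReal :=
  ((sys.fit T : ℝ) : EReal) + setIndicator sys.powerSet T + ((etaT / 2 * frobSq T : ℝ) : EReal)

/-- The objective of the inner problem; `etaW = etaT = 0` gives the unregularized one. -/
def objective (etaW etaT : ℝ) (z : sys.Primal) : EReal :=
  sys.theta1 z.Q + sys.theta2 z.X + sys.theta3 etaW z.W + sys.theta4 etaT z.T

/-- The linear equality constraints of the inner problem. -/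
def LinFeasible (z : sys.Primal) : Prop :=
  z.Q - sys.opA z.W = 0 ∧ z.X - sys.opF z.W = 0 ∧ z.W - sys.opS z.T = 0

/-- `z` is a global optimal solution of the inner problem with the given regularization. -/
def IsGlobalSolution (etaW etaT : ℝ) (z : sys.Primal) : Prop :=
  sys.LinFeasible z ∧ sys.objective etaW etaT z < ⊤ ∧
    ∀ z', sys.LinFeasible z' → sys.objective etaW etaT z ≤ sys.objective etaW etaT z'

/-! ### Lagrangian, primal-dual solutions, ADMM -/

/-- The part of the augmented Lagrangian that couples the blocks: the multiplier terms and the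
quadratic penalty terms with parameter `rho`. -/
def coupling (rho : ℝ) (Q : sys.QMat) (X : sys.XMat) (W : sys.WMat) (T : sys.TMat)
    (L : sys.Dual) : ℝ :=
  reInner L.q (Q - sys.opA W) + rho / 2 * frobSq (Q - sys.opA W)
    + reInner L.x (X - sys.opF W) + rho / 2 * frobSq (X - sys.opF W)
    + reInner L.w (W - sys.opS T) + rho / 2 * frobSq (W - sys.opS T)

/-- The augmented Lagrangian with penalty `rho`; for `rho = 0` it is the ordinary Lagrangian. -/
def augLagrangian (etaW etaT rho : ℝ) (z : sys.Primal) (L : sys.Dual) : EReal :=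
  sys.objective etaW etaT z + ((sys.coupling rho z.Q z.X z.W z.T L : ℝ) : EReal)

/-- `(z, L)` is a primal-dual solution, that is, a saddle point (with finite value) of the ordinary
Lagrangian of the inner problem. -/
def IsPrimalDualSolution (etaW etaT : ℝ) (z : sys.Primal) (L : sys.Dual) : Prop :=
  sys.objective etaW etaT z < ⊤ ∧
    (∀ L', sys.augLagrangian etaW etaT 0 z L' ≤ sys.augLagrangian etaW etaT 0 z L) ∧
    ∀ z', sys.augLagrangian etaW etaT 0 z L ≤ sys.augLagrangian etaW etaT 0 z' L

/-- The KKT conditions of the inner problem: primal feasibility and stationarity of the Lagrangian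
in each block. The adjoints of `opA`, `opF`, `opS` for `Re tr(Aᴴ B)` are `L ↦ L (A_nᴴ)ᵀ`,
`L ↦ L ((F_{ℓS}ᴴ)ᴴ)ᵀ` and `L ↦ Pᵀ L`. -/
def IsKKT (etaW etaT : ℝ) (z : sys.Primal) (L : sys.Dual) : Prop :=
  sys.LinFeasible z ∧
    IsSubgradient sys.theta1 (-L.q) z.Q ∧
    IsSubgradient sys.theta2 (-L.x) z.X ∧
    IsSubgradient (sys.theta3 etaW) (L.q * sys.maskMatᴴᵀ + L.x * sys.idftᴴᵀ - L.w) z.W ∧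
    IsSubgradient (sys.theta4 etaT) ((sys.selMat ℂ)ᵀ * L.w) z.T

/-- One cycle of the ADMM, from `(z, L)` to `(z', L')`. Each block minimizes the augmented
Lagrangian over that block, the other variables being fixed at their latest values; the terms
`θ_i` of the other blocks, which are constants in the subproblem, are left out. -/
def ADMMStep (etaW etaT rho : ℝ) (z : sys.Primal) (L : sys.Dual) (z' : sys.Primal)
    (L' : sys.Dual) : Prop :=
  IsArgmin (fun Q => sys.theta1 Q + ((sys.coupling rho Q z.X z.W z.T L : ℝ) : EReal)) z'.Q ∧
  IsArgmin (fun X => sys.theta2 X + ((sys.coupling rho z'.Q X z.W z.T L : ℝ) : EReal)) z'.X ∧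
  IsArgmin (fun W => sys.theta3 etaW W + ((sys.coupling rho z'.Q z'.X W z.T L : ℝ) : EReal))
    z'.W ∧
  IsArgmin (fun T => sys.theta4 etaT T + ((sys.coupling rho z'.Q z'.X z'.W T L : ℝ) : EReal))
    z'.T ∧
  L'.q = L.q + (rho : ℂ) • (z'.Q - sys.opA z'.W) ∧
  L'.x = L.x + (rho : ℂ) • (z'.X - sys.opF z'.W) ∧
  L'.w = L.w + (rho : ℂ) • (z'.W - sys.opS z'.T)

/-- `(z τ, L τ)`, `τ = 0, 1, …`, is a sequence of ADMM iterates. -/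
def IsADMM (etaW etaT rho : ℝ) (z : ℕ → sys.Primal) (L : ℕ → sys.Dual) : Prop :=
  ∀ τ, sys.ADMMStep etaW etaT rho (z τ) (L τ) (z (τ + 1)) (L (τ + 1))

end HybridSystem

end

/-! ### The real inner product on complex matrices -/

section MatrixInner

variable {m n m' n' : ℕ}

/-! A four-block cyclic ADMM need not converge in general. Here the coupling is a chain: `Q` and `X`
meet only `W`, and `W` meets `T`. In each constraint the block updated first (`Q`, `X`, `W`)
therefore faces the image of a block updated later (`W`, `W`, `T`), so the classical two-block
Lyapunov argument applies to each constraint separately.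

For one constraint take the squared multiplier error over 2ρ plus ρ/2 times the squared error of the
later block's image. `lyapunov_identity` gives its exact change over a cycle. In the sum of the
three identities the cross terms are controlled by the monotonicity of the optimality conditions,
and the `W` equation cancels the `Q` and `X` terms against the `W` term. What remains
(`lyapunov_step`) is a decrease of at least η_w‖W' − W*‖² + η_t‖T' − T*‖² plus the squared residuals
of `Q` and `X`. No upper bound on ρ enters. The decreases tend to 0, so `W` and `T` converge by
strong convexity, and `Q` and `X` follow from their residuals.

The multipliers are only bounded at first. They have a limit along an ultrafilter, this limit is
again optimal for the primal limit (`optimality_of_tendsto`), and the Lyapunov function centred at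
it is antitone with limit 0 along the ultrafilter, hence tends to 0. This gives convergence of the
whole dual sequence.

The argument needs one saddle point to start. `exists_optimality` eliminates `Q`, `X`, `W`,
minimizes over `T`, and obtains multipliers from Hahn–Banach separation, with the origin as Slater
point since the mask and clipping levels are positive.

For vanishing regularization, the feasible set is independent of the parameters, so the optimality
inequality against a fixed competitor passes to the limit. The realification claims are linear
algebra. -/

theorem reInner_eq_sum (A B : Matrix (Fin m) (Fin n) ℂ) :
    reInner A B = ∑ i, ∑ j, ((A i j).re * (B i j).re + (A i j).im * (B i j).im) := by
  rw [Finset.sum_comm]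
  simp [reInner, Matrix.trace, Matrix.mul_apply]

theorem frobSq_eq_sum (A : Matrix (Fin m) (Fin n) ℂ) :
    frobSq A = ∑ i, ∑ j, ((A i j).re * (A i j).re + (A i j).im * (A i j).im) := by
  simp [frobSq, Complex.sq_norm, Complex.normSq_apply]

theorem reInner_self (A : Matrix (Fin m) (Fin n) ℂ) : reInner A A = frobSq A := by
  rw [reInner_eq_sum, frobSq_eq_sum]

theorem reInner_comm (A B : Matrix (Fin m) (Fin n) ℂ) : reInner A B = reInner B A := by
  simp only [reInner_eq_sum, mul_comm]

theorem reInner_add_left (A B C : Matrix (Fin m) (Fin n) ℂ) :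
    reInner (A + B) C = reInner A C + reInner B C := by
  simp [reInner, Matrix.add_mul]

theorem reInner_add_right (A B C : Matrix (Fin m) (Fin n) ℂ) :
    reInner A (B + C) = reInner A B + reInner A C := by
  simp [reInner, Matrix.mul_add]

theorem reInner_neg_left (A B : Matrix (Fin m) (Fin n) ℂ) : reInner (-A) B = -reInner A B := by
  simp [reInner]

theorem reInner_neg_right (A B : Matrix (Fin m) (Fin n) ℂ) : reInner A (-B) = -reInner A B := by
  simp [reInner]

theorem reInner_sub_left (A B C : Matrix (Fin m) (Fin n) ℂ) :
    reInner (A - B) C = reInner A C - reInner B C := by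
  simp [reInner, Matrix.sub_mul]

theorem reInner_sub_right (A B C : Matrix (Fin m) (Fin n) ℂ) :
    reInner A (B - C) = reInner A B - reInner A C := by
  simp [reInner, Matrix.mul_sub]

theorem reInner_smul_left (t : ℝ) (A B : Matrix (Fin m) (Fin n) ℂ) :
    reInner (t • A) B = t * reInner A B := by
  simp only [reInner_eq_sum, Finset.mul_sum, Matrix.smul_apply, Complex.smul_re, Complex.smul_im,
    smul_eq_mul]
  exact Finset.sum_congr rfl fun i _ => Finset.sum_congr rfl fun j _ => by ring

theorem reInner_smul_right (t : ℝ) (A B : Matrix (Fin m) (Fin n) ℂ) :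
    reInner A (t • B) = t * reInner A B := by
  rw [reInner_comm, reInner_smul_left, reInner_comm]

@[simp] theorem reInner_zero_right (A : Matrix (Fin m) (Fin n) ℂ) : reInner A 0 = 0 := by
  simp [reInner]

@[simp] theorem frobSq_zero : frobSq (0 : Matrix (Fin m) (Fin n) ℂ) = 0 := by
  simp [frobSq]

theorem frobSq_nonneg (A : Matrix (Fin m) (Fin n) ℂ) : 0 ≤ frobSq A := by
  unfold frobSq; positivity

theorem sq_norm_apply_le_frobSq (A : Matrix (Fin m) (Fin n) ℂ) (i : Fin m) (j : Fin n) :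
    ‖A i j‖ ^ 2 ≤ frobSq A :=
  (Finset.single_le_sum (f := fun j => ‖A i j‖ ^ 2) (fun _ _ => by positivity)
    (Finset.mem_univ j)).trans
    (Finset.single_le_sum (f := fun i => ∑ j, ‖A i j‖ ^ 2) (fun _ _ => by positivity)
      (Finset.mem_univ i))

theorem frobSq_pos {A : Matrix (Fin m) (Fin n) ℂ} (hA : A ≠ 0) : 0 < frobSq A := by
  refine (frobSq_nonneg A).lt_of_ne fun h => hA ?_
  ext i j
  have := sq_norm_apply_le_frobSq A i j
  rw [← h] at this
  simpa using le_antisymm this (by positivity)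

theorem frobSq_add_smul (A B : Matrix (Fin m) (Fin n) ℂ) (t : ℝ) :
    frobSq (A + t • B) = frobSq A + t * (2 * reInner A B) + t ^ 2 * frobSq B := by
  simp only [← reInner_self, reInner_add_left, reInner_add_right, reInner_smul_left,
    reInner_smul_right, reInner_comm B A]
  ring

theorem continuous_frobSq : Continuous (frobSq : Matrix (Fin m) (Fin n) ℂ → ℝ) := by
  unfold frobSq
  fun_prop

theorem continuous_reInner :
    Continuous fun p : Matrix (Fin m) (Fin n) ℂ × Matrix (Fin m) (Fin n) ℂ => reInner p.1 p.2 := by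
  simp only [reInner_eq_sum]
  fun_prop

theorem tendsto_reInner {α : Type*} {l : Filter α} {f g : α → Matrix (Fin m) (Fin n) ℂ}
    {A B : Matrix (Fin m) (Fin n) ℂ} (hf : Tendsto f l (𝓝 A)) (hg : Tendsto g l (𝓝 B)) :
    Tendsto (fun a => reInner (f a) (g a)) l (𝓝 (reInner A B)) := by
  have h1 : Tendsto (fun p : Matrix (Fin m) (Fin n) ℂ × Matrix (Fin m) (Fin n) ℂ =>
    reInner p.1 p.2) (𝓝 (A, B)) (𝓝 (reInner A B)) := continuous_reInner.tendsto (A, B)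
  have := h1.comp (hf.prodMk_nhds hg)
  exact this

theorem tendsto_of_frobSq_sub {α : Type*} {l : Filter α} {f : α → Matrix (Fin m) (Fin n) ℂ}
    {A : Matrix (Fin m) (Fin n) ℂ} (h : Tendsto (fun a => frobSq (f a - A)) l (𝓝 0)) :
    Tendsto f l (𝓝 A) := by
  refine tendsto_pi_nhds.2 fun i => tendsto_pi_nhds.2 fun j => ?_
  rw [tendsto_iff_norm_sub_tendsto_zero]
  have h2 : Tendsto (fun a => ‖f a i j - A i j‖ ^ 2) l (𝓝 0) :=
    squeeze_zero (fun _ => by positivity)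
      (fun a => by simpa using sq_norm_apply_le_frobSq (f a - A) i j) h
  simpa using h2.sqrt

theorem isCompact_setOf_norm_apply_le (R : ℝ) :
    IsCompact {A : Matrix (Fin m) (Fin n) ℂ | ∀ i j, ‖A i j‖ ≤ R} := by
  have h : IsCompact {A : Fin m → Fin n → ℂ | ∀ i j, ‖A i j‖ ≤ R} := by
    have h' : {A : Fin m → Fin n → ℂ | ∀ i j, ‖A i j‖ ≤ R} = Set.univ.pi fun _ : Fin m =>
        Set.univ.pi fun _ : Fin n => Metric.closedBall (0 : ℂ) R := by
      ext A
      simp [Set.mem_pi]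
    rw [h']
    exact isCompact_univ_pi fun _ => isCompact_univ_pi fun _ => isCompact_closedBall 0 R
  exact h

theorem isCompact_setOf_frobSq_le (R : ℝ) :
    IsCompact {A : Matrix (Fin m) (Fin n) ℂ | frobSq A ≤ R} := by
  refine (isCompact_setOf_norm_apply_le (m := m) (n := n) (1 + R)).of_isClosed_subset
    (isClosed_le continuous_frobSq continuous_const) fun A hA i j => ?_
  have := (sq_norm_apply_le_frobSq A i j).trans hA
  -- From 2x ≤ 1 + x² and x ≥ 0, a bound x² ≤ R yields x ≤ 1 + R without square roots.
  nlinarith [sq_nonneg (‖A i j‖ - 1), norm_nonneg (A i j)]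

/-- Riesz representation for the real inner product. -/
theorem exists_reInner_eq (f : Matrix (Fin m) (Fin n) ℂ →ₗ[ℝ] ℝ) :
    ∃ L : Matrix (Fin m) (Fin n) ℂ, ∀ A, f A = reInner L A := by
  -- The matrix units and their multiples by the imaginary unit form a real orthonormal basis; the
  -- representer collects the values of `f` on it.
  refine ⟨Matrix.of fun i j => ⟨f (Matrix.single i j 1), f (Matrix.single i j Complex.I)⟩,
    fun A => ?_⟩
  conv_lhs => rw [Matrix.matrix_eq_sum_single A]
  simp only [map_sum, reInner_eq_sum]
  refine Finset.sum_congr rfl fun i _ => Finset.sum_congr rfl fun j _ => ?_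
  have : Matrix.single i j (A i j) = (A i j).re • Matrix.single i j (1 : ℂ)
      + (A i j).im • Matrix.single i j Complex.I := by
    rw [Matrix.smul_single, Matrix.smul_single, ← Matrix.single_add]
    congr 1
    apply Complex.ext <;> simp
  rw [this, map_add, map_smul, map_smul]
  simp [mul_comm]

/-- The dual updates scale by a complex number, whereas the convex analysis is over ℝ. -/
theorem ofReal_smul_matrix (t : ℝ) (A : Matrix (Fin m) (Fin n) ℂ) : (t : ℂ) • A = t • A := by
  ext i j
  simp

theorem sq_norm_convex_combination {a b : ℝ} (ha : 0 ≤ a) (hb : 0 ≤ b) (hab : a + b = 1)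
    (x y : ℂ) : ‖a • x + b • y‖ ^ 2 ≤ a * ‖x‖ ^ 2 + b * ‖y‖ ^ 2 := by
  have h := ((convexOn_norm (E := ℂ) convex_univ).pow (fun _ _ => norm_nonneg _) 2).2
    (Set.mem_univ x) (Set.mem_univ y) ha hb hab
  simpa using h

theorem convexOn_frobSq : ConvexOn ℝ Set.univ (frobSq : Matrix (Fin m) (Fin n) ℂ → ℝ) := by
  refine ⟨convex_univ, fun A _ B _ a b ha hb hab => ?_⟩
  simp only [frobSq, smul_eq_mul, Finset.mul_sum, ← Finset.sum_add_distrib]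
  exact Finset.sum_le_sum fun i _ => Finset.sum_le_sum fun j _ => by
    simpa using sq_norm_convex_combination ha hb hab (A i j) (B i j)

/-- A linear map between complex matrices has a unique real matrix in the coordinates `realify`. -/
theorem existsUnique_realify_matrix
    (f : Matrix (Fin m) (Fin n) ℂ →ₗ[ℝ] Matrix (Fin m') (Fin n') ℂ) :
    ∃! AR : Matrix ((Fin n' × Fin m') ⊕ (Fin n' × Fin m')) ((Fin n × Fin m) ⊕ (Fin n × Fin m)) ℝ,
      ∀ W, realify (f W) = AR *ᵥ realify W := by
  -- With this inverse, `realify` becomes a real-linear isomorphism, and the required matrix is that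
  -- of `f` conjugated by it.
  let unstack : ((Fin n × Fin m) ⊕ (Fin n × Fin m) → ℝ) →ₗ[ℝ] Matrix (Fin m) (Fin n) ℂ :=
    { toFun := fun v => Matrix.of fun i j => ⟨v (.inl (j, i)), v (.inr (j, i))⟩
      map_add' := fun v w => by ext i j; apply Complex.ext <;> simp
      map_smul' := fun t v => by ext i j; apply Complex.ext <;> simp }
  let stack : Matrix (Fin m') (Fin n') ℂ →ₗ[ℝ] ((Fin n' × Fin m') ⊕ (Fin n' × Fin m') → ℝ) :=
    { toFun := realify
      map_add' := fun v w => by ext (p | p) <;> simp [realify, Matrix.vec]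
      map_smul' := fun t v => by ext (p | p) <;> simp [realify, Matrix.vec] }
  have h1 : ∀ W, unstack (realify W) = W := fun W => by
    ext i j; apply Complex.ext <;> simp [unstack, realify, Matrix.vec]
  have h2 : ∀ v, realify (unstack v) = v := fun v => by
    ext (p | p) <;> simp [unstack, realify, Matrix.vec]
  refine ⟨LinearMap.toMatrix' (stack ∘ₗ f ∘ₗ unstack), fun W => ?_, fun AR hAR => ?_⟩
  · rw [LinearMap.toMatrix'_mulVec]
    simp [h1, stack]
  · apply Matrix.toLin'.injective
    rw [Matrix.toLin'_toMatrix']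
    refine LinearMap.ext fun v => ?_
    have := hAR (unstack v)
    rw [h2] at this
    simp [stack, this]

end MatrixInner

/-! ### Minimization of convex functions -/

section Minimization

/-- Divide by t and let t decrease to 0. -/
theorem nonneg_of_forall_add_sq_mul_nonneg {a b : ℝ}
    (h : ∀ t : ℝ, 0 < t → t ≤ 1 → 0 ≤ t * a + t ^ 2 * b) : 0 ≤ a := by
  have h1 : Tendsto (fun t : ℝ => a + t * b) (𝓝[>] 0) (𝓝 (a + 0 * b)) :=
    ((continuous_const.add (continuous_id.mul continuous_const)).tendsto 0).mono_left
      nhdsWithin_le_nhds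
  rw [zero_mul, add_zero] at h1
  refine ge_of_tendsto h1 ?_
  filter_upwards [Ioc_mem_nhdsGT (zero_lt_one' ℝ)] with t ht
  have := h t ht.1 ht.2
  refine nonneg_of_mul_nonneg_right (a := t) ?_ ht.1
  linarith

/-- First-order optimality of a minimizer of the sum of a convex function and a quadratic one. -/
theorem variational_of_isMin {E : Type*} [AddCommGroup E] [Module ℝ E] {C : Set E}
    {N q : E → ℝ} (hN : ConvexOn ℝ C N) {x : E} {D R : E → ℝ}
    (hq : ∀ (d : E) (t : ℝ), q (x + t • d) = q x + t * D d + t ^ 2 * R d) (hx : x ∈ C)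
    (hmin : ∀ y ∈ C, N x + q x ≤ N y + q y) {y : E} (hy : y ∈ C) : N x ≤ N y + D (y - x) := by
  suffices 0 ≤ N y + D (y - x) - N x by linarith
  refine nonneg_of_forall_add_sq_mul_nonneg (b := R (y - x)) fun t ht0 ht1 => ?_
  -- Minimality is tested on the segment from x to y: convexity handles `N`, the exact expansion
  -- handles `q`, so `N` need not be differentiable.
  have e : x + t • (y - x) = (1 - t) • x + t • y := by module
  have h1 := hN.2 hx hy (sub_nonneg.2 ht1) ht0.le (by ring)
  have h2 := hmin _ (hN.1 hx hy (sub_nonneg.2 ht1) ht0.le (by ring))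
  rw [← e] at h1 h2
  have h3 := hq (y - x) t
  simp only [smul_eq_mul] at h1
  linarith

/-- First-order optimality at x together with the exact expansion of `q` shows that the value at y
exceeds the minimum by at least `R (y - x)`, which is positive unless y = x. -/
theorem eq_of_isMin_of_isMin {E : Type*} [AddCommGroup E] [Module ℝ E] {C : Set E}
    {N q : E → ℝ} (hN : ConvexOn ℝ C N) {x y : E} {D R : E → ℝ}
    (hq : ∀ (d : E) (t : ℝ), q (x + t • d) = q x + t * D d + t ^ 2 * R d)
    (hR : ∀ d, d ≠ 0 → 0 < R d) (hx : x ∈ C)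
    (hmin : ∀ y ∈ C, N x + q x ≤ N y + q y) (hy : y ∈ C)
    (hmin' : ∀ z ∈ C, N y + q y ≤ N z + q z) : y = x := by
  by_contra hne
  have h1 := variational_of_isMin hN hq hx hmin hy
  have h2 := hq (y - x) 1
  have h3 := hR _ (sub_ne_zero.2 hne)
  have h4 := hmin' x hx
  simp only [one_smul, add_sub_cancel] at h2
  linarith

theorem exists_isMin_of_coercive {m n : ℕ} {C : Set (Matrix (Fin m) (Fin n) ℂ)} (hC : IsClosed C)
    (hne : C.Nonempty) {h : Matrix (Fin m) (Fin n) ℂ → ℝ} (hh : Continuous h) {c k : ℝ}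
    (hc : 0 < c) (hco : ∀ y, c * frobSq y + k ≤ h y) : ∃ x ∈ C, ∀ y ∈ C, h x ≤ h y := by
  obtain ⟨y₀, hy₀⟩ := hne
  have hK : IsCompact (C ∩ {y | h y ≤ h y₀}) := by
    refine (isCompact_setOf_frobSq_le ((h y₀ - k) / c)).of_isClosed_subset
      (hC.inter (isClosed_le hh continuous_const)) fun y hy => ?_
    have h1 := hco y
    have h2 : h y ≤ h y₀ := hy.2
    rw [Set.mem_ofPred_eq, le_div_iff₀ hc]
    linarith
  obtain ⟨x, hx, hmin⟩ := hK.exists_isMinOn ⟨y₀, hy₀, le_refl (h y₀)⟩ hh.continuousOn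
  refine ⟨x, hx.1, fun y hy => ?_⟩
  rcases le_total (h y) (h y₀) with hle | hle
  · exact hmin ⟨hy, hle⟩
  · exact hx.2.trans hle

/-- Lagrange multipliers under Slater's condition, for the constraint `B T ∈ C₁`. -/
theorem exists_multiplier {E F : Type*} [AddCommGroup E] [Module ℝ E] [AddCommGroup F] [Module ℝ F]
    [TopologicalSpace F] [IsTopologicalAddGroup F] [ContinuousSMul ℝ F] {C₁ : Set F}
    (hC₁ : Convex ℝ C₁) (h₁ : 0 ∈ interior C₁) {C₃ : Set E} (h₃ : 0 ∈ C₃) {g : E → ℝ}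
    (hg : ConvexOn ℝ C₃ g) (B : E →ₗ[ℝ] F) {μ : ℝ} (hmin : ∀ T ∈ C₃, B T ∈ C₁ → μ ≤ g T) :
    ∃ f : F →L[ℝ] ℝ, ∀ T ∈ C₃, ∀ u ∈ C₁, μ ≤ g T + f (u - B T) := by
  -- Strict epigraph of the value function of the perturbed problem. Interior and strict inequality
  -- make it open, so it can be separated from the point (0, μ).
  let D : Set (F × ℝ) := ⋃ T ∈ C₃, {p | p.1 + B T ∈ interior C₁ ∧ g T < p.2}
  have hD : ∀ p : F × ℝ, p ∈ D ↔ ∃ T ∈ C₃, p.1 + B T ∈ interior C₁ ∧ g T < p.2 := fun p => by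
    simp only [D, Set.mem_iUnion, Set.mem_ofPred_eq, exists_prop]
  have hopen : IsOpen D := isOpen_biUnion fun T _ =>
    (isOpen_interior.preimage (by fun_prop : Continuous fun p : F × ℝ => p.1 + B T)).inter
      (isOpen_lt continuous_const continuous_snd)
  have hconv : Convex ℝ D := by
    intro p hp p' hp' a b ha hb hab
    rw [hD] at hp hp' ⊢
    obtain ⟨T, hT, hu, hr⟩ := hp
    obtain ⟨T', hT', hu', hr'⟩ := hp'
    refine ⟨a • T + b • T', hg.1 hT hT' ha hb hab, ?_, ?_⟩
    · have := hC₁.interior hu hu' ha hb hab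
      convert this using 1
      simp only [Prod.fst_add, Prod.smul_fst, map_add, map_smul]
      module
    · refine (hg.2 hT hT' ha hb hab).trans_lt ?_
      simp only [Prod.snd_add, Prod.smul_snd, smul_eq_mul]
      -- The strict inequality for the first point survives only if its weight is positive; if a = 0
      -- the second point supplies it.
      rcases ha.eq_or_lt with rfl | ha'
      · obtain rfl : b = 1 := by linarith
        linarith
      · nlinarith [mul_lt_mul_of_pos_left hr ha', mul_le_mul_of_nonneg_left hr'.le hb]
  have hnot : ((0 : F), μ) ∉ D := by
    rw [hD]
    rintro ⟨T, hT, hu, hr⟩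
    rw [zero_add] at hu
    exact absurd (hmin T hT (interior_subset hu)) (not_le.2 hr)
  obtain ⟨φ, hφ⟩ := geometric_hahn_banach_open_point hconv hopen hnot
  have hsplit : ∀ (u : F) (r : ℝ), φ (u, r) = φ (u, 0) + r * φ (0, 1) := fun u r => by
    rw [← smul_eq_mul, ← map_smul, ← map_add]
    simp
  set ν : ℝ := φ (0, 1) with hν
  -- Slater's condition excludes a vertical separating hyperplane: over the perturbation 0, the set
  -- `D` contains points of height above μ.
  have hν_neg : ν < 0 := by
    have hmem : ((0 : F), max (g 0) μ + 1) ∈ D := (hD _).2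
      ⟨0, h₃, by simpa using h₁, (le_max_left _ _).trans_lt (lt_add_one _)⟩
    have := hφ _ hmem
    rw [hsplit, hsplit 0 μ] at this
    have h4 := le_max_right (g 0) μ
    by_contra hcon
    rw [not_lt] at hcon
    nlinarith
  let f : F →L[ℝ] ℝ := (ν⁻¹) • (φ.comp (ContinuousLinearMap.inl ℝ F ℝ))
  have hf : ∀ u, ν * f u = φ (u, 0) := fun u => by
    simp [f, hν_neg.ne]
  refine ⟨f, fun T hT u hu => ?_⟩
  -- Apply the separation at height g T + ε, divide by ν < 0 and let ε tend to 0. The extension to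
  -- all of `C₁` is by closure, as a convex set with nonempty interior lies in the closure of its
  -- interior.
  have hint : ∀ u ∈ interior C₁, μ ≤ g T + f (u - B T) := fun u hu => by
    refine le_of_forall_pos_le_add fun ε hε => ?_
    have := hφ (u - B T, g T + ε) ((hD _).2 ⟨T, hT, by simpa using hu, by simpa using hε⟩)
    have hz : φ ((0 : F), (0 : ℝ)) = 0 := map_zero φ
    rw [hsplit, hsplit 0 μ, hz, ← hf] at this
    by_contra hcon
    rw [not_le] at hcon
    nlinarith
  have hcl : IsClosed {u | μ ≤ g T + f (u - B T)} :=
    isClosed_le continuous_const (by fun_prop)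
  have hmem : u ∈ closure (interior C₁) := by
    rw [hC₁.closure_interior_eq_closure_of_nonempty_interior ⟨0, h₁⟩]
    exact subset_closure hu
  exact closure_minimal (fun u hu => hint u hu) hcl hmem

end Minimization

/-! ### Extended-valued minimization -/

theorem isArgmin_iff {α : Type} {f : α → EReal} {C : Set α} {g : α → ℝ}
    (hf : ∀ y ∈ C, f y = (g y : EReal)) (hf' : ∀ y ∉ C, f y = ⊤) {x : α} :
    IsArgmin f x ↔ x ∈ C ∧ ∀ y ∈ C, g x ≤ g y := by
  constructor
  · rintro ⟨h1, h2⟩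
    have hx : x ∈ C := by
      by_contra hx
      rw [hf' x hx] at h1
      exact lt_irrefl _ h1
    refine ⟨hx, fun y hy => ?_⟩
    have := h2 y
    rwa [hf x hx, hf y hy, EReal.coe_le_coe_iff] at this
  · rintro ⟨hx, h⟩
    refine ⟨by rw [hf x hx]; exact EReal.coe_lt_top _, fun y => ?_⟩
    by_cases hy : y ∈ C
    · rw [hf x hx, hf y hy, EReal.coe_le_coe_iff]
      exact h y hy
    · rw [hf' y hy]
      exact le_top

/-! ### The multiplier and penalty terms of one constraint -/

section Penalty

variable {m n : ℕ}

/-- The multiplier term plus the quadratic penalty of one equality constraint with residual `Y`. -/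
noncomputable def penalty (rho : ℝ) (L Y : Matrix (Fin m) (Fin n) ℂ) : ℝ :=
  reInner L Y + rho / 2 * frobSq Y

/-- The gradient `L + rho • Y` has the form of the multiplier update; hence subproblem optimality
can be written with updated multipliers. -/
theorem penalty_add_smul (rho : ℝ) (L Y Z : Matrix (Fin m) (Fin n) ℂ) (t : ℝ) :
    penalty rho L (Y + t • Z) = penalty rho L Y + t * reInner (L + rho • Y) Z
      + t ^ 2 * (rho / 2 * frobSq Z) := by
  simp only [penalty, frobSq_add_smul, reInner_add_left, reInner_add_right, reInner_smul_left,
    reInner_smul_right]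
  ring

theorem continuous_penalty (rho : ℝ) (L : Matrix (Fin m) (Fin n) ℂ) :
    Continuous (penalty rho L) := by
  unfold penalty
  exact (continuous_reInner.comp (continuous_const.prodMk continuous_id)).add
    (continuous_const.mul continuous_frobSq)

/-- Completing the square: ‖L + ρY‖² ≥ 0. -/
theorem le_penalty {rho : ℝ} (hrho : 0 < rho) (L Y : Matrix (Fin m) (Fin n) ℂ) :
    -(frobSq L / (2 * rho)) ≤ penalty rho L Y := by
  have h := frobSq_nonneg (L + rho • Y)
  rw [frobSq_add_smul] at h
  have : penalty rho L Y + frobSq L / (2 * rho)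
      = (frobSq L + rho * (2 * reInner L Y) + rho ^ 2 * frobSq Y) / (2 * rho) := by
    unfold penalty
    field_simp
    ring
  have h2 : 0 ≤ penalty rho L Y + frobSq L / (2 * rho) := by
    rw [this]
    positivity
  linarith

/-- The change over one ADMM cycle of the Lyapunov function, for one equality constraint. -/
theorem lyapunov_identity {rho : ℝ} (hrho : rho ≠ 0) (q e a a' : Matrix (Fin m) (Fin n) ℂ) :
    frobSq (q + rho • (e - a')) / (2 * rho) + rho / 2 * frobSq a' + rho / 2 * frobSq (e - a)
      = frobSq q / (2 * rho) + rho / 2 * frobSq a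
        + reInner (q + rho • (e - a)) e - reInner (q + rho • (e - a')) a' := by
  simp only [← reInner_self, reInner_add_left, reInner_add_right, reInner_smul_left,
    reInner_smul_right, reInner_sub_left, reInner_sub_right, reInner_comm e q, reInner_comm a' q,
    reInner_comm a' e, reInner_comm a e]
  field_simp
  ring

end Penalty

namespace HybridSystem

variable (sys : HybridSystem)

/-! ### The linear operators -/

/-- `opA` as a real-linear map. -/
noncomputable def opALin : sys.WMat →ₗ[ℝ] sys.QMat where
  toFun := sys.opA
  map_add' V W := by simp [opA, Matrix.add_mul]
  map_smul' t W := by simp [opA]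

/-- `opF` as a real-linear map. -/
noncomputable def opFLin : sys.WMat →ₗ[ℝ] sys.XMat where
  toFun := sys.opF
  map_add' V W := by simp [opF, Matrix.add_mul]
  map_smul' t W := by simp [opF]

/-- `opS` as a real-linear map. -/
def opSLin : sys.TMat →ₗ[ℝ] sys.WMat where
  toFun := sys.opS
  map_add' V W := by ext; simp [opS]
  map_smul' t W := by ext; simp [opS]

@[simp] theorem opA_zero : sys.opA 0 = 0 := sys.opALin.map_zero
@[simp] theorem opF_zero : sys.opF 0 = 0 := sys.opFLin.map_zero
@[simp] theorem opS_zero : sys.opS 0 = 0 := sys.opSLin.map_zero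
theorem opA_add (V W : sys.WMat) : sys.opA (V + W) = sys.opA V + sys.opA W :=
  sys.opALin.map_add V W
theorem opF_add (V W : sys.WMat) : sys.opF (V + W) = sys.opF V + sys.opF W :=
  sys.opFLin.map_add V W
theorem opS_add (V W : sys.TMat) : sys.opS (V + W) = sys.opS V + sys.opS W :=
  sys.opSLin.map_add V W
theorem opA_sub (V W : sys.WMat) : sys.opA (V - W) = sys.opA V - sys.opA W :=
  sys.opALin.map_sub V W
theorem opF_sub (V W : sys.WMat) : sys.opF (V - W) = sys.opF V - sys.opF W :=
  sys.opFLin.map_sub V W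
theorem opS_sub (V W : sys.TMat) : sys.opS (V - W) = sys.opS V - sys.opS W :=
  sys.opSLin.map_sub V W
theorem opA_smul (t : ℝ) (W : sys.WMat) : sys.opA (t • W) = t • sys.opA W :=
  sys.opALin.map_smul t W
theorem opF_smul (t : ℝ) (W : sys.WMat) : sys.opF (t • W) = t • sys.opF W :=
  sys.opFLin.map_smul t W
theorem opS_smul (t : ℝ) (T : sys.TMat) : sys.opS (t • T) = t • sys.opS T :=
  sys.opSLin.map_smul t T

theorem continuous_opA : Continuous sys.opA :=
  Continuous.matrix_mul continuous_id continuous_const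

theorem continuous_opF : Continuous sys.opF :=
  Continuous.matrix_mul continuous_id continuous_const

theorem continuous_opS : Continuous sys.opS := by
  unfold opS
  exact continuous_matrix fun a s => by simpa using continuous_id.matrix_elem (sys.conn a) s

theorem opS_eq_selMat_mul (T : sys.TMat) : sys.opS T = sys.selMat ℂ * T := by
  ext a s
  simp [opS, selMat, Matrix.mul_apply]

theorem vec_opS (T : sys.TMat) : (sys.opS T).vec =
    ((1 : Matrix (Fin sys.S) (Fin sys.S) ℂ) ⊗ₖ sys.selMat ℂ) *ᵥ T.vec := by
  rw [Matrix.kronecker_mulVec_vec, opS_eq_selMat_mul]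
  simp

theorem realify_opS (T : sys.TMat) : realify (sys.opS T) =
    Matrix.fromBlocks ((1 : Matrix (Fin sys.S) (Fin sys.S) ℝ) ⊗ₖ sys.selMat ℝ) 0
      0 ((1 : Matrix (Fin sys.S) (Fin sys.S) ℝ) ⊗ₖ sys.selMat ℝ) *ᵥ realify T := by
  ext (⟨s, a⟩ | ⟨s, a⟩) <;>
  simp [realify, opS, selMat, Matrix.mulVec, dotProduct, Fintype.sum_prod_type, Matrix.one_apply,
    Matrix.vec]

theorem conjTranspose_transpose_conjTranspose {m n : ℕ} (A : Matrix (Fin m) (Fin n) ℂ) :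
    Aᴴᵀᴴ = Aᵀ := by
  ext
  simp

theorem reInner_opA (L : sys.QMat) (W : sys.WMat) :
    reInner L (sys.opA W) = reInner (L * sys.maskMatᴴᵀ) W := by
  unfold reInner opA
  rw [Matrix.conjTranspose_mul, ← Matrix.mul_assoc, Matrix.trace_mul_comm, ← Matrix.mul_assoc,
    conjTranspose_transpose_conjTranspose]

theorem reInner_opF (L : sys.XMat) (W : sys.WMat) :
    reInner L (sys.opF W) = reInner (L * sys.idftᴴᵀ) W := by
  unfold reInner opF
  rw [Matrix.conjTranspose_mul, ← Matrix.mul_assoc, Matrix.trace_mul_comm, ← Matrix.mul_assoc,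
    conjTranspose_transpose_conjTranspose]

theorem reInner_opS (L : sys.WMat) (T : sys.TMat) :
    reInner L (sys.opS T) = reInner ((sys.selMat ℂ)ᵀ * L) T := by
  have h : ((sys.selMat ℂ)ᵀ)ᴴ = sys.selMat ℂ := by
    ext a m
    simp only [selMat, Matrix.conjTranspose_apply, Matrix.transpose_apply, Matrix.of_apply]
    split_ifs <;> simp
  unfold reInner
  rw [opS_eq_selMat_mul, Matrix.conjTranspose_mul, h, Matrix.mul_assoc]

/-! ### The constraint sets and the data-fit term -/

theorem zero_mem_maskSet (hr : ∀ j, 0 < sys.r j) : 0 ∈ sys.maskSet := fun a j => by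
  simpa using (hr j).le

theorem zero_mem_clipSet (hchi : 0 < sys.chi) : 0 ∈ sys.clipSet := fun a j => by
  simpa using hchi.le

theorem zero_mem_powerSet (hP : ∀ s, 0 < sys.P s) : 0 ∈ sys.powerSet := fun s => by
  simpa using (hP s).le

/-- Half of Slater's condition at the origin; the other half is `zero_mem_interior_clipSet`. -/
theorem zero_mem_interior_maskSet (hr : ∀ j, 0 < sys.r j) : 0 ∈ interior sys.maskSet := by
  refine mem_interior.2 ⟨⋂ a, ⋂ j, {Q | ‖Q a j‖ ^ 2 < sys.r j}, fun Q hQ a j => ?_, ?_, ?_⟩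
  · simp only [Set.mem_iInter] at hQ
    exact le_of_lt (hQ a j)
  · exact isOpen_iInter_of_finite fun a => isOpen_iInter_of_finite fun j =>
      isOpen_lt (by fun_prop) continuous_const
  · simp [hr]

theorem zero_mem_interior_clipSet (hchi : 0 < sys.chi) : 0 ∈ interior sys.clipSet := by
  refine mem_interior.2 ⟨⋂ a, ⋂ j, {Q | ‖Q a j‖ < sys.chi}, fun Q hQ a j => ?_, ?_, ?_⟩
  · simp only [Set.mem_iInter] at hQ
    exact le_of_lt (hQ a j)
  · exact isOpen_iInter_of_finite fun a => isOpen_iInter_of_finite fun j =>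
      isOpen_lt (by fun_prop) continuous_const
  · simp [hchi]

theorem isClosed_maskSet : IsClosed sys.maskSet := by
  have : sys.maskSet = ⋂ a, ⋂ j, {Q | ‖Q a j‖ ^ 2 ≤ sys.r j} := by
    ext Q; simp [maskSet]
  rw [this]
  exact isClosed_iInter fun a => isClosed_iInter fun j => isClosed_le (by fun_prop) continuous_const

theorem isClosed_clipSet : IsClosed sys.clipSet := by
  have : sys.clipSet = ⋂ a, ⋂ j, {Q | ‖Q a j‖ ≤ sys.chi} := by
    ext Q; simp [clipSet]
  rw [this]
  exact isClosed_iInter fun a => isClosed_iInter fun j => isClosed_le (by fun_prop) continuous_const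

theorem isClosed_powerSet : IsClosed sys.powerSet := by
  have : sys.powerSet =
      ⋂ s, {T | (sys.Nt : ℝ) / (sys.NRF : ℝ) * (∑ m, ‖T m s‖ ^ 2) ≤ sys.P s} := by
    ext Q; simp [powerSet]
  rw [this]
  exact isClosed_iInter fun s => isClosed_le (by fun_prop) continuous_const

theorem isCompact_maskSet : IsCompact sys.maskSet := by
  refine (isCompact_setOf_norm_apply_le (1 + ∑ j, |sys.r j|)).of_isClosed_subset
    sys.isClosed_maskSet fun Q hQ a j => ?_
  have h1 := hQ a j
  have h2 := Finset.single_le_sum (f := fun j => |sys.r j|) (fun _ _ => abs_nonneg _)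
    (Finset.mem_univ j)
  have h3 := le_abs_self (sys.r j)
  change |sys.r j| ≤ _ at h2
  nlinarith [sq_nonneg (‖Q a j‖ - 1), norm_nonneg (Q a j)]

theorem isCompact_clipSet : IsCompact sys.clipSet :=
  isCompact_setOf_norm_apply_le sys.chi

theorem convex_maskSet : Convex ℝ sys.maskSet := fun Q hQ Q' hQ' a b ha hb hab i j => by
  refine (sq_norm_convex_combination ha hb hab (Q i j) (Q' i j)).trans ?_
  calc a * ‖Q i j‖ ^ 2 + b * ‖Q' i j‖ ^ 2 ≤ a * sys.r j + b * sys.r j := by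
        gcongr
        exacts [hQ i j, hQ' i j]
    _ = sys.r j := by rw [← add_mul, hab, one_mul]

theorem convex_clipSet : Convex ℝ sys.clipSet := fun Q hQ Q' hQ' a b ha hb hab i j => by
  have h := (convexOn_norm (E := ℂ) convex_univ).2
    (Set.mem_univ (Q i j)) (Set.mem_univ (Q' i j)) ha hb hab
  refine h.trans ?_
  calc a * ‖Q i j‖ + b * ‖Q' i j‖ ≤ a * sys.chi + b * sys.chi := by
        gcongr
        exacts [hQ i j, hQ' i j]
    _ = sys.chi := by rw [← add_mul, hab, one_mul]

theorem convex_powerSet : Convex ℝ sys.powerSet := fun T hT T' hT' a b ha hb hab s => by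
  have h : ∑ m, ‖(a • T + b • T') m s‖ ^ 2
      ≤ a * ∑ m, ‖T m s‖ ^ 2 + b * ∑ m, ‖T' m s‖ ^ 2 := by
    rw [Finset.mul_sum, Finset.mul_sum, ← Finset.sum_add_distrib]
    exact Finset.sum_le_sum fun m _ => by
      simpa using sq_norm_convex_combination ha hb hab (T m s) (T' m s)
  have hc : 0 ≤ (sys.Nt : ℝ) / (sys.NRF : ℝ) := by positivity
  have h1 := mul_le_mul_of_nonneg_left h hc
  have h2 := mul_le_mul_of_nonneg_left (hT s) ha
  have h3 := mul_le_mul_of_nonneg_left (hT' s) hb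
  have h4 : a * sys.P s + b * sys.P s = sys.P s := by rw [← add_mul, hab, one_mul]
  linarith

theorem fit_nonneg (T : sys.TMat) : 0 ≤ sys.fit T := by
  unfold fit; positivity

theorem continuous_fit : Continuous sys.fit := by
  unfold fit
  simp only [Matrix.mulVec, dotProduct]
  fun_prop

theorem convexOn_fit : ConvexOn ℝ Set.univ sys.fit := by
  refine ⟨convex_univ, fun T _ T' _ a b ha hb hab => ?_⟩
  simp only [fit, smul_eq_mul, Finset.mul_sum, ← Finset.sum_add_distrib]
  refine Finset.sum_le_sum fun s _ => Finset.sum_le_sum fun k _ => Finset.sum_le_sum fun i _ => ?_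
  refine le_trans (le_of_eq ?_) (sq_norm_convex_combination ha hb hab
    ((sys.B k s *ᵥ (fun m => T m s)) i - sys.sym k s i)
    ((sys.B k s *ᵥ (fun m => T' m s)) i - sys.sym k s i))
  have h1 : (fun m => (a • T + b • T') m s) = a • (fun m => T m s) + b • (fun m => T' m s) := rfl
  -- Since a + b = 1, the residual is affine in `T`, so convexity of the squared modulus suffices.
  have h2 : sys.sym k s i = a • sys.sym k s i + b • sys.sym k s i := by
    rw [← add_smul, hab, one_smul]
  rw [h1, Matrix.mulVec_add, Matrix.mulVec_smul, Matrix.mulVec_smul]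
  conv_lhs => rw [h2]
  simp only [Pi.add_apply, Pi.smul_apply, smul_sub]
  congr 2
  ring

/-! ### The objective terms as real-valued functions on the constraint sets -/

variable {sys}

theorem theta1_of_mem {Q : sys.QMat} (h : Q ∈ sys.maskSet) : sys.theta1 Q = 0 := if_pos h
theorem theta1_of_notMem {Q : sys.QMat} (h : Q ∉ sys.maskSet) : sys.theta1 Q = ⊤ := if_neg h
theorem theta2_of_mem {X : sys.XMat} (h : X ∈ sys.clipSet) : sys.theta2 X = 0 := if_pos h
theorem theta2_of_notMem {X : sys.XMat} (h : X ∉ sys.clipSet) : sys.theta2 X = ⊤ := if_neg h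

theorem theta4_of_mem {T : sys.TMat} (etaT : ℝ) (h : T ∈ sys.powerSet) :
    sys.theta4 etaT T = ((sys.fit T + etaT / 2 * frobSq T : ℝ) : EReal) := by
  rw [theta4, setIndicator, if_pos h, add_zero, EReal.coe_add]

theorem theta4_of_notMem {T : sys.TMat} (etaT : ℝ) (h : T ∉ sys.powerSet) :
    sys.theta4 etaT T = ⊤ := by
  rw [theta4, setIndicator, if_neg h, EReal.coe_add_top, EReal.top_add_coe]

/-- The domain of the objective. -/
def Primal.InSets (z : sys.Primal) : Prop :=
  z.Q ∈ sys.maskSet ∧ z.X ∈ sys.clipSet ∧ z.T ∈ sys.powerSet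

theorem objective_of_inSets {z : sys.Primal} (etaW etaT : ℝ) (h : z.InSets) :
    sys.objective etaW etaT z
      = ((etaW / 2 * frobSq z.W + (sys.fit z.T + etaT / 2 * frobSq z.T) : ℝ) : EReal) := by
  rw [objective, theta1_of_mem h.1, theta2_of_mem h.2.1, theta4_of_mem etaT h.2.2, theta3,
    zero_add, zero_add, EReal.coe_add (etaW / 2 * _)]

/-- In `EReal` the sum of `⊤` and `⊥` is `⊥`, so one infinite term forces an infinite objective only
once `⊥` is excluded for the others. -/
theorem theta1_ne_bot (Q : sys.QMat) : sys.theta1 Q ≠ ⊥ := by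
  by_cases h : Q ∈ sys.maskSet
  · simp [theta1_of_mem h]
  · simp [theta1_of_notMem h]

theorem theta2_ne_bot (X : sys.XMat) : sys.theta2 X ≠ ⊥ := by
  by_cases h : X ∈ sys.clipSet
  · simp [theta2_of_mem h]
  · simp [theta2_of_notMem h]

theorem theta4_ne_bot (etaT : ℝ) (T : sys.TMat) : sys.theta4 etaT T ≠ ⊥ := by
  by_cases h : T ∈ sys.powerSet
  · rw [theta4_of_mem etaT h]
    exact EReal.coe_ne_bot _
  · simp [theta4_of_notMem etaT h]

theorem objective_of_not_inSets {z : sys.Primal} (etaW etaT : ℝ) (h : ¬ z.InSets) :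
    sys.objective etaW etaT z = ⊤ := by
  have h12 : sys.theta1 z.Q + sys.theta2 z.X ≠ ⊥ := by
    simp [EReal.add_eq_bot_iff, theta1_ne_bot, theta2_ne_bot]
  have h123 : sys.theta1 z.Q + sys.theta2 z.X + sys.theta3 etaW z.W ≠ ⊥ := by
    rw [Ne, EReal.add_eq_bot_iff, not_or]
    exact ⟨h12, EReal.coe_ne_bot _⟩
  by_cases h4 : z.T ∈ sys.powerSet
  · have h3 : sys.theta1 z.Q + sys.theta2 z.X = ⊤ := by
      by_cases h1 : z.Q ∈ sys.maskSet
      · have h2 : z.X ∉ sys.clipSet := fun h2 => h ⟨h1, h2, h4⟩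
        rw [theta2_of_notMem h2, EReal.add_top_of_ne_bot (theta1_ne_bot _)]
      · rw [theta1_of_notMem h1, EReal.top_add_of_ne_bot (theta2_ne_bot _)]
    rw [objective, h3, theta3, EReal.top_add_coe, EReal.top_add_of_ne_bot (theta4_ne_bot _ _)]
  · rw [objective, theta4_of_notMem etaT h4, EReal.add_top_of_ne_bot h123]

theorem objective_lt_top_iff {z : sys.Primal} (etaW etaT : ℝ) :
    sys.objective etaW etaT z < ⊤ ↔ z.InSets := by
  by_cases h : z.InSets
  · rw [objective_of_inSets etaW etaT h]
    exact ⟨fun _ => h, fun _ => EReal.coe_lt_top _⟩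
  · rw [objective_of_not_inSets etaW etaT h]
    simp [h]

variable (sys)

/-! ### The subproblems of one ADMM cycle -/

theorem coupling_eq (rho : ℝ) (Q : sys.QMat) (X : sys.XMat) (W : sys.WMat) (T : sys.TMat)
    (L : sys.Dual) : sys.coupling rho Q X W T L = penalty rho L.q (Q - sys.opA W)
      + penalty rho L.x (X - sys.opF W) + penalty rho L.w (W - sys.opS T) := by
  unfold coupling penalty
  ring

variable {sys}

theorem coupling_add_smul_Q (rho : ℝ) (Q : sys.QMat) (X : sys.XMat) (W : sys.WMat) (T : sys.TMat)
    (L : sys.Dual) (d : sys.QMat) (t : ℝ) :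
    sys.coupling rho (Q + t • d) X W T L = sys.coupling rho Q X W T L
      + t * reInner (L.q + rho • (Q - sys.opA W)) d + t ^ 2 * (rho / 2 * frobSq d) := by
  have e : Q + t • d - sys.opA W = (Q - sys.opA W) + t • d := by module
  rw [coupling_eq, coupling_eq, e, penalty_add_smul]
  ring

theorem coupling_add_smul_X (rho : ℝ) (Q : sys.QMat) (X : sys.XMat) (W : sys.WMat) (T : sys.TMat)
    (L : sys.Dual) (d : sys.XMat) (t : ℝ) :
    sys.coupling rho Q (X + t • d) W T L = sys.coupling rho Q X W T L
      + t * reInner (L.x + rho • (X - sys.opF W)) d + t ^ 2 * (rho / 2 * frobSq d) := by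
  have e : X + t • d - sys.opF W = (X - sys.opF W) + t • d := by module
  rw [coupling_eq, coupling_eq, e, penalty_add_smul]
  ring

theorem coupling_add_smul_W (rho : ℝ) (Q : sys.QMat) (X : sys.XMat) (W : sys.WMat) (T : sys.TMat)
    (L : sys.Dual) (d : sys.WMat) (t : ℝ) :
    sys.coupling rho Q X (W + t • d) T L = sys.coupling rho Q X W T L
      + t * (reInner (L.w + rho • (W - sys.opS T)) d
        - reInner (L.q + rho • (Q - sys.opA W)) (sys.opA d)
        - reInner (L.x + rho • (X - sys.opF W)) (sys.opF d))
      + t ^ 2 * (rho / 2 * (frobSq (sys.opA d) + frobSq (sys.opF d) + frobSq d)) := by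
  have e₁ : Q - sys.opA (W + t • d) = (Q - sys.opA W) + (-t) • sys.opA d := by
    rw [opA_add, opA_smul]; module
  have e₂ : X - sys.opF (W + t • d) = (X - sys.opF W) + (-t) • sys.opF d := by
    rw [opF_add, opF_smul]; module
  have e₃ : W + t • d - sys.opS T = (W - sys.opS T) + t • d := by module
  rw [coupling_eq, coupling_eq, e₁, e₂, e₃, penalty_add_smul, penalty_add_smul, penalty_add_smul]
  ring

theorem coupling_add_smul_T (rho : ℝ) (Q : sys.QMat) (X : sys.XMat) (W : sys.WMat) (T : sys.TMat)
    (L : sys.Dual) (d : sys.TMat) (t : ℝ) :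
    sys.coupling rho Q X W (T + t • d) L = sys.coupling rho Q X W T L
      + t * -reInner (L.w + rho • (W - sys.opS T)) (sys.opS d)
      + t ^ 2 * (rho / 2 * frobSq (sys.opS d)) := by
  have e : W - sys.opS (T + t • d) = (W - sys.opS T) + (-t) • sys.opS d := by
    rw [opS_add, opS_smul]; module
  rw [coupling_eq, coupling_eq, e, penalty_add_smul]
  ring

theorem continuous_coupling_Q (rho : ℝ) (X : sys.XMat) (W : sys.WMat) (T : sys.TMat)
    (L : sys.Dual) : Continuous fun Q => sys.coupling rho Q X W T L := by
  simp only [coupling_eq]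
  exact (((continuous_penalty rho L.q).comp (continuous_id.sub continuous_const)).add
    continuous_const).add continuous_const

theorem continuous_coupling_X (rho : ℝ) (Q : sys.QMat) (W : sys.WMat) (T : sys.TMat)
    (L : sys.Dual) : Continuous fun X => sys.coupling rho Q X W T L := by
  simp only [coupling_eq]
  exact (continuous_const.add
    ((continuous_penalty rho L.x).comp (continuous_id.sub continuous_const))).add continuous_const

theorem continuous_coupling_W (rho : ℝ) (Q : sys.QMat) (X : sys.XMat) (T : sys.TMat)
    (L : sys.Dual) : Continuous fun W => sys.coupling rho Q X W T L := by
  simp only [coupling_eq]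
  exact (((continuous_penalty rho L.q).comp (continuous_const.sub sys.continuous_opA)).add
    ((continuous_penalty rho L.x).comp (continuous_const.sub sys.continuous_opF))).add
    ((continuous_penalty rho L.w).comp (continuous_id.sub continuous_const))

theorem continuous_coupling_T (rho : ℝ) (Q : sys.QMat) (X : sys.XMat) (W : sys.WMat)
    (L : sys.Dual) : Continuous fun T => sys.coupling rho Q X W T L := by
  simp only [coupling_eq]
  exact continuous_const.add
    ((continuous_penalty rho L.w).comp (continuous_const.sub sys.continuous_opS))

/-- A lower bound uniform in the primal variables: the regularization terms alone then make the `W`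
and `T` subproblems coercive. -/
theorem exists_le_coupling {rho : ℝ} (hrho : 0 < rho) (L : sys.Dual) :
    ∃ k : ℝ, ∀ Q X W T, k ≤ sys.coupling rho Q X W T L :=
  ⟨-(frobSq L.q / (2 * rho)) + -(frobSq L.x / (2 * rho)) + -(frobSq L.w / (2 * rho)),
    fun Q X W T => by
      rw [coupling_eq]
      gcongr <;> exact le_penalty hrho _ _⟩

section Blocks

variable {etaW etaT rho : ℝ} {Q : sys.QMat} {X : sys.XMat} {W : sys.WMat} {T : sys.TMat}
  {L : sys.Dual}

/-- The redundant `0 +` gives the shape N + q used by `variational_of_isMin`, with N = 0; likewise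
for `X` and `W`. For `T` the convex part N is `fit`. -/
theorem isArgmin_Q_iff : IsArgmin (fun Q => sys.theta1 Q
      + ((sys.coupling rho Q X W T L : ℝ) : EReal)) Q ↔
    Q ∈ sys.maskSet ∧ ∀ Q' ∈ sys.maskSet,
      0 + sys.coupling rho Q X W T L ≤ 0 + sys.coupling rho Q' X W T L :=
  isArgmin_iff (g := fun Q => 0 + sys.coupling rho Q X W T L)
    (fun Q hQ => by simp [theta1_of_mem hQ])
    (fun Q hQ => by simp [theta1_of_notMem hQ])

theorem isArgmin_X_iff : IsArgmin (fun X => sys.theta2 X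
      + ((sys.coupling rho Q X W T L : ℝ) : EReal)) X ↔
    X ∈ sys.clipSet ∧ ∀ X' ∈ sys.clipSet,
      0 + sys.coupling rho Q X W T L ≤ 0 + sys.coupling rho Q X' W T L :=
  isArgmin_iff (g := fun X => 0 + sys.coupling rho Q X W T L)
    (fun X hX => by simp [theta2_of_mem hX])
    (fun X hX => by simp [theta2_of_notMem hX])

theorem isArgmin_W_iff : IsArgmin (fun W => sys.theta3 etaW W
      + ((sys.coupling rho Q X W T L : ℝ) : EReal)) W ↔
    W ∈ Set.univ ∧ ∀ W' ∈ Set.univ, 0 + (etaW / 2 * frobSq W + sys.coupling rho Q X W T L)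
      ≤ 0 + (etaW / 2 * frobSq W' + sys.coupling rho Q X W' T L) :=
  isArgmin_iff (g := fun W => 0 + (etaW / 2 * frobSq W + sys.coupling rho Q X W T L))
    (fun W _ => by rw [theta3, zero_add, EReal.coe_add (etaW / 2 * _)])
    (fun W hW => absurd (Set.mem_univ W) hW)

theorem isArgmin_T_iff : IsArgmin (fun T => sys.theta4 etaT T
      + ((sys.coupling rho Q X W T L : ℝ) : EReal)) T ↔
    T ∈ sys.powerSet ∧ ∀ T' ∈ sys.powerSet,
      sys.fit T + (etaT / 2 * frobSq T + sys.coupling rho Q X W T L)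
        ≤ sys.fit T' + (etaT / 2 * frobSq T' + sys.coupling rho Q X W T' L) :=
  isArgmin_iff (g := fun T => sys.fit T + (etaT / 2 * frobSq T + sys.coupling rho Q X W T L))
    (fun T hT => by rw [theta4_of_mem _ hT, ← add_assoc, EReal.coe_add (_ + _)])
    (fun T hT => by simp [theta4_of_notMem _ hT])

theorem quadratic_W (d : sys.WMat) (t : ℝ) :
    etaW / 2 * frobSq (W + t • d) + sys.coupling rho Q X (W + t • d) T L
      = (etaW / 2 * frobSq W + sys.coupling rho Q X W T L)
      + t * (etaW * reInner W d + (reInner (L.w + rho • (W - sys.opS T)) d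
        - reInner (L.q + rho • (Q - sys.opA W)) (sys.opA d)
        - reInner (L.x + rho • (X - sys.opF W)) (sys.opF d)))
      + t ^ 2 * (etaW / 2 * frobSq d
        + rho / 2 * (frobSq (sys.opA d) + frobSq (sys.opF d) + frobSq d)) := by
  rw [frobSq_add_smul, coupling_add_smul_W]
  ring

theorem quadratic_T (d : sys.TMat) (t : ℝ) :
    etaT / 2 * frobSq (T + t • d) + sys.coupling rho Q X W (T + t • d) L
      = (etaT / 2 * frobSq T + sys.coupling rho Q X W T L)
      + t * (etaT * reInner T d - reInner (L.w + rho • (W - sys.opS T)) (sys.opS d))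
      + t ^ 2 * (etaT / 2 * frobSq d + rho / 2 * frobSq (sys.opS d)) := by
  rw [frobSq_add_smul, coupling_add_smul_T]
  ring

/-- Compactness of the mask set gives existence, the penalty's quadratic term gives uniqueness. -/
theorem existsUnique_argmin_Q (hr : ∀ j, 0 < sys.r j) (hrho : 0 < rho) (X : sys.XMat)
    (W : sys.WMat) (T : sys.TMat) (L : sys.Dual) :
    ∃! Q, IsArgmin (fun Q => sys.theta1 Q + ((sys.coupling rho Q X W T L : ℝ) : EReal)) Q := by
  simp only [isArgmin_Q_iff]
  have hcont : Continuous fun Q => 0 + sys.coupling rho Q X W T L := 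
    continuous_const.add (continuous_coupling_Q rho X W T L)
  obtain ⟨Q, hQ, hmin⟩ := sys.isCompact_maskSet.exists_isMinOn ⟨0, sys.zero_mem_maskSet hr⟩
    hcont.continuousOn
  refine ⟨Q, ⟨hQ, fun Q' hQ' => hmin hQ'⟩, fun Q' hQ' => ?_⟩
  exact eq_of_isMin_of_isMin (N := fun _ => 0) (q := fun Q => sys.coupling rho Q X W T L)
    (convexOn_const 0 sys.convex_maskSet) (coupling_add_smul_Q rho Q X W T L)
    (fun d hd => mul_pos (half_pos hrho) (frobSq_pos hd)) hQ (fun Q' hQ' => hmin hQ')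
    hQ'.1 hQ'.2

theorem existsUnique_argmin_X (hchi : 0 < sys.chi) (hrho : 0 < rho) (Q : sys.QMat)
    (W : sys.WMat) (T : sys.TMat) (L : sys.Dual) :
    ∃! X, IsArgmin (fun X => sys.theta2 X + ((sys.coupling rho Q X W T L : ℝ) : EReal)) X := by
  simp only [isArgmin_X_iff]
  have hcont : Continuous fun X => 0 + sys.coupling rho Q X W T L := 
    continuous_const.add (continuous_coupling_X rho Q W T L)
  obtain ⟨X, hX, hmin⟩ := sys.isCompact_clipSet.exists_isMinOn ⟨0, sys.zero_mem_clipSet hchi⟩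
    hcont.continuousOn
  refine ⟨X, ⟨hX, fun X' hX' => hmin hX'⟩, fun X' hX' => ?_⟩
  exact eq_of_isMin_of_isMin (N := fun _ => 0) (q := fun X => sys.coupling rho Q X W T L)
    (convexOn_const 0 sys.convex_clipSet) (coupling_add_smul_X rho Q X W T L)
    (fun d hd => mul_pos (half_pos hrho) (frobSq_pos hd)) hX (fun X' hX' => hmin hX')
    hX'.1 hX'.2

theorem existsUnique_argmin_W (hW : 0 < etaW) (hrho : 0 < rho) (Q : sys.QMat) (X : sys.XMat)
    (T : sys.TMat) (L : sys.Dual) :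
    ∃! W, IsArgmin
      (fun W => sys.theta3 etaW W + ((sys.coupling rho Q X W T L : ℝ) : EReal)) W := by
  simp only [isArgmin_W_iff]
  have hcont : Continuous fun W => 0 + (etaW / 2 * frobSq W + sys.coupling rho Q X W T L) :=
    continuous_const.add ((continuous_const.mul continuous_frobSq).add
      (continuous_coupling_W rho Q X T L))
  obtain ⟨k, hk⟩ := exists_le_coupling hrho L
  obtain ⟨W, hWm, hmin⟩ := exists_isMin_of_coercive isClosed_univ ⟨0, Set.mem_univ _⟩ hcont
    (half_pos hW) (k := k) fun W => by
      rw [zero_add]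
      exact add_le_add le_rfl (hk Q X W T)
  refine ⟨W, ⟨hWm, hmin⟩, fun W' hW' => ?_⟩
  exact eq_of_isMin_of_isMin (N := fun _ => 0)
    (q := fun W => etaW / 2 * frobSq W + sys.coupling rho Q X W T L) (convexOn_const 0 convex_univ)
    quadratic_W
    (fun d hd => by
      have := frobSq_pos hd
      have := frobSq_nonneg (sys.opA d)
      have := frobSq_nonneg (sys.opF d)
      positivity) hWm hmin hW'.1 hW'.2

theorem existsUnique_argmin_T (hP : ∀ s, 0 < sys.P s) (hT : 0 < etaT) (hrho : 0 < rho)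
    (Q : sys.QMat) (X : sys.XMat) (W : sys.WMat) (L : sys.Dual) :
    ∃! T, IsArgmin
      (fun T => sys.theta4 etaT T + ((sys.coupling rho Q X W T L : ℝ) : EReal)) T := by
  simp only [isArgmin_T_iff]
  have hcont : Continuous fun T =>
      sys.fit T + (etaT / 2 * frobSq T + sys.coupling rho Q X W T L) :=
    sys.continuous_fit.add ((continuous_const.mul continuous_frobSq).add
      (continuous_coupling_T rho Q X W L))
  obtain ⟨k, hk⟩ := exists_le_coupling hrho L
  obtain ⟨T, hTm, hmin⟩ := exists_isMin_of_coercive sys.isClosed_powerSet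
    ⟨0, sys.zero_mem_powerSet hP⟩ hcont (half_pos hT) (k := k) fun T => by
      have := hk Q X W T
      have := sys.fit_nonneg T
      linarith
  refine ⟨T, ⟨hTm, hmin⟩, fun T' hT' => ?_⟩
  exact eq_of_isMin_of_isMin
    (q := fun T => etaT / 2 * frobSq T + sys.coupling rho Q X W T L) (sys.convexOn_fit.subset (Set.subset_univ _) sys.convex_powerSet)
    quadratic_T
    (fun d hd => by
      have := frobSq_pos hd
      have := frobSq_nonneg (sys.opS d)
      positivity) hTm hmin hT'.1 hT'.2

end Blocks

theorem existsUnique_admmStep (hr : ∀ j, 0 < sys.r j) (hchi : 0 < sys.chi)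
    (hP : ∀ s, 0 < sys.P s) {etaW etaT rho : ℝ} (hW : 0 < etaW) (hT : 0 < etaT) (hrho : 0 < rho)
    (z : sys.Primal) (L : sys.Dual) :
    ∃! p : sys.Primal × sys.Dual, sys.ADMMStep etaW etaT rho z L p.1 p.2 := by
  obtain ⟨Q, hQ, hQ'⟩ := existsUnique_argmin_Q hr hrho z.X z.W z.T L
  obtain ⟨X, hX, hX'⟩ := existsUnique_argmin_X hchi hrho Q z.W z.T L
  obtain ⟨W, hWm, hW'⟩ := existsUnique_argmin_W hW hrho Q X z.T L
  obtain ⟨T, hTm, hT'⟩ := existsUnique_argmin_T hP hT hrho Q X W L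
  refine ⟨(⟨Q, X, W, T⟩, ⟨L.q + (rho : ℂ) • (Q - sys.opA W), L.x + (rho : ℂ) • (X - sys.opF W),
    L.w + (rho : ℂ) • (W - sys.opS T)⟩), ⟨hQ, hX, hWm, hTm, rfl, rfl, rfl⟩, ?_⟩
  rintro ⟨⟨Q₁, X₁, W₁, T₁⟩, ⟨q, x, w⟩⟩ ⟨h1, h2, h3, h4, h5, h6, h7⟩
  obtain rfl := hQ' _ h1
  obtain rfl := hX' _ h2
  obtain rfl := hW' _ h3
  obtain rfl := hT' _ h4
  simp only at h5 h6 h7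
  rw [h5, h6, h7]

theorem existsUnique_isADMM (hr : ∀ j, 0 < sys.r j) (hchi : 0 < sys.chi)
    (hP : ∀ s, 0 < sys.P s) {etaW etaT rho : ℝ} (hW : 0 < etaW) (hT : 0 < etaT) (hrho : 0 < rho)
    (z₀ : sys.Primal) (L₀ : sys.Dual) :
    ∃! u : (ℕ → sys.Primal) × (ℕ → sys.Dual),
      u.1 0 = z₀ ∧ u.2 0 = L₀ ∧ sys.IsADMM etaW etaT rho u.1 u.2 := by
  choose step hstep hstep' using fun p : sys.Primal × sys.Dual =>
    existsUnique_admmStep hr hchi hP hW hT hrho p.1 p.2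
  let v : ℕ → sys.Primal × sys.Dual := fun τ => step^[τ] (z₀, L₀)
  have hv : ∀ τ, v (τ + 1) = step (v τ) := fun τ => Function.iterate_succ_apply' step τ _
  refine ⟨(fun τ => (v τ).1, fun τ => (v τ).2), ⟨rfl, rfl, fun τ => ?_⟩, ?_⟩
  · simp only [hv]
    exact hstep (v τ)
  · rintro ⟨z, L⟩ ⟨h0, h0', h⟩
    have key : ∀ τ, (z τ, L τ) = v τ := by
      intro τ
      induction τ with
      | zero => exact Prod.ext h0 h0'
      | succ τ ih =>
        rw [hv, ← ih]
        exact hstep' (z τ, L τ) (z (τ + 1), L (τ + 1)) (h τ)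
    exact Prod.ext (funext fun τ => congrArg Prod.fst (key τ))
      (funext fun τ => congrArg Prod.snd (key τ))

/-- The first-order optimality conditions of one ADMM cycle. -/
structure StepOptimality (etaW etaT rho : ℝ) (z : sys.Primal) (L : sys.Dual) (z' : sys.Primal)
    (L' : sys.Dual) : Prop where
  mem : z'.InSets
  varQ : ∀ Q ∈ sys.maskSet, 0 ≤ reInner (L.q + rho • (z'.Q - sys.opA z.W)) (Q - z'.Q)
  varX : ∀ X ∈ sys.clipSet, 0 ≤ reInner (L.x + rho • (z'.X - sys.opF z.W)) (X - z'.X)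
  varW : ∀ V : sys.WMat, etaW * reInner z'.W V + reInner (L.w + rho • (z'.W - sys.opS z.T)) V
    = reInner L'.q (sys.opA V) + reInner L'.x (sys.opF V)
  varT : ∀ T ∈ sys.powerSet, sys.fit z'.T ≤ sys.fit T
    + (etaT * reInner z'.T (T - z'.T) - reInner L'.w (sys.opS (T - z'.T)))
  dualq : L'.q = L.q + rho • (z'.Q - sys.opA z'.W)
  dualx : L'.x = L.x + rho • (z'.X - sys.opF z'.W)
  dualw : L'.w = L.w + rho • (z'.W - sys.opS z'.T)

/-- The update order decides which multiplier appears. A block updated before its partner (`Q`, `X`,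
and `W` against `T`) sees the intermediate multiplier, built with the partner's old value; a block
updated last in its constraint sees the new multiplier. -/
theorem ADMMStep.stepOptimality {etaW etaT rho : ℝ} {z z' : sys.Primal} {L L' : sys.Dual}
    (h : sys.ADMMStep etaW etaT rho z L z' L') : StepOptimality etaW etaT rho z L z' L' := by
  obtain ⟨h1, h2, h3, h4, h5, h6, h7⟩ := h
  rw [isArgmin_Q_iff] at h1
  rw [isArgmin_X_iff] at h2
  rw [isArgmin_W_iff] at h3
  rw [isArgmin_T_iff] at h4
  rw [ofReal_smul_matrix] at h5 h6 h7
  refine ⟨⟨h1.1, h2.1, h4.1⟩, fun Q hQ => ?_, fun X hX => ?_, fun V => ?_, fun T hT => ?_,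
    h5, h6, h7⟩
  · simpa using variational_of_isMin (N := fun _ => 0)
      (q := fun Q => sys.coupling rho Q z.X z.W z.T L) (convexOn_const 0 sys.convex_maskSet)
      (coupling_add_smul_Q rho z'.Q z.X z.W z.T L) h1.1 h1.2 hQ
  · simpa using variational_of_isMin (N := fun _ => 0)
      (q := fun X => sys.coupling rho z'.Q X z.W z.T L) (convexOn_const 0 sys.convex_clipSet)
      (coupling_add_smul_X rho z'.Q z'.X z.W z.T L) h2.1 h2.2 hX
  · have key := fun V => variational_of_isMin (N := fun _ => 0)
      (q := fun W => etaW / 2 * frobSq W + sys.coupling rho z'.Q z'.X W z.T L)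
      (convexOn_const 0 convex_univ)
      (quadratic_W (etaW := etaW) (rho := rho) (Q := z'.Q) (X := z'.X) (T := z.T) (L := L))
      h3.1 h3.2 (Set.mem_univ (z'.W + V))
    -- `W` is unconstrained, so the inequalities for V and −V combine to an equality.
    have e1 := key V
    have e2 := key (-V)
    simp only [add_sub_cancel_left] at e1 e2
    have e3 : sys.opA (-V) = -sys.opA V := sys.opALin.map_neg V
    have e4 : sys.opF (-V) = -sys.opF V := sys.opFLin.map_neg V
    simp only [e3, e4, reInner_neg_right] at e2
    rw [h5, h6]
    linarith
  · rw [h7]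
    exact variational_of_isMin
      (q := fun T => etaT / 2 * frobSq T + sys.coupling rho z'.Q z'.X z'.W T L)
      (sys.convexOn_fit.subset (Set.subset_univ _) sys.convex_powerSet)
      quadratic_T h4.1 h4.2 hT

/-! ### Primal-dual optimality -/

/-- The optimality conditions of the inner problem as variational inequalities. -/
structure Optimality (etaW etaT : ℝ) (z : sys.Primal) (L : sys.Dual) : Prop where
  eqQ : z.Q = sys.opA z.W
  eqX : z.X = sys.opF z.W
  eqW : z.W = sys.opS z.T
  mem : z.InSets
  varQ : ∀ Q ∈ sys.maskSet, 0 ≤ reInner L.q (Q - z.Q)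
  varX : ∀ X ∈ sys.clipSet, 0 ≤ reInner L.x (X - z.X)
  varW : ∀ V : sys.WMat, etaW * reInner z.W V + reInner L.w V
    = reInner L.q (sys.opA V) + reInner L.x (sys.opF V)
  varT : ∀ T ∈ sys.powerSet, sys.fit z.T ≤ sys.fit T
    + (etaT * reInner z.T (T - z.T) - reInner L.w (sys.opS (T - z.T)))

/-- Gradient inequality for the convex function η/2‖·‖²; it turns the variational inequalities into
subgradient inequalities. -/
theorem half_frobSq_add_le {m n : ℕ} {eta : ℝ} (heta : 0 ≤ eta) (A B : Matrix (Fin m) (Fin n) ℂ) :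
    eta / 2 * frobSq A + eta * reInner A (B - A) ≤ eta / 2 * frobSq B := by
  have h := frobSq_add_smul A (B - A) 1
  rw [one_smul, add_sub_cancel] at h
  nlinarith [mul_nonneg heta (frobSq_nonneg (B - A))]

theorem coupling_zero (Q : sys.QMat) (X : sys.XMat) (W : sys.WMat) (T : sys.TMat) (L : sys.Dual) :
    sys.coupling 0 Q X W T L = reInner L.q (Q - sys.opA W) + reInner L.x (X - sys.opF W)
      + reInner L.w (W - sys.opS T) := by
  simp [coupling]

theorem coupling_of_linFeasible {rho : ℝ} {z : sys.Primal} (h : sys.LinFeasible z) (L : sys.Dual) :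
    sys.coupling rho z.Q z.X z.W z.T L = 0 := by
  simp [coupling, h.1, h.2.1, h.2.2]

namespace Optimality

variable {etaW etaT : ℝ} {z : sys.Primal} {L : sys.Dual}

theorem linFeasible (h : Optimality etaW etaT z L) : sys.LinFeasible z :=
  ⟨sub_eq_zero.2 h.eqQ, sub_eq_zero.2 h.eqX, sub_eq_zero.2 h.eqW⟩

theorem isKKT (h : Optimality etaW etaT z L) (hW : 0 ≤ etaW) (hT : 0 ≤ etaT) :
    sys.IsKKT etaW etaT z L := by
  refine ⟨h.linFeasible, ⟨?_, fun Q => ?_⟩, ⟨?_, fun X => ?_⟩, ⟨EReal.coe_lt_top _, fun W => ?_⟩,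
    ⟨?_, fun T => ?_⟩⟩
  · rw [theta1_of_mem h.mem.1]
    exact EReal.zero_lt_top
  · by_cases hQ : Q ∈ sys.maskSet
    · rw [theta1_of_mem h.mem.1, theta1_of_mem hQ, zero_add, ← EReal.coe_zero,
        EReal.coe_le_coe_iff, reInner_neg_left]
      linarith [h.varQ Q hQ]
    · rw [theta1_of_notMem hQ]
      exact le_top
  · rw [theta2_of_mem h.mem.2.1]
    exact EReal.zero_lt_top
  · by_cases hX : X ∈ sys.clipSet
    · rw [theta2_of_mem h.mem.2.1, theta2_of_mem hX, zero_add, ← EReal.coe_zero,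
        EReal.coe_le_coe_iff, reInner_neg_left]
      linarith [h.varX X hX]
    · rw [theta2_of_notMem hX]
      exact le_top
  · rw [theta3, theta3, ← EReal.coe_add, EReal.coe_le_coe_iff, reInner_sub_left, reInner_add_left,
      ← reInner_opA, ← reInner_opF]
    linarith [h.varW (W - z.W), half_frobSq_add_le hW z.W W]
  · rw [theta4_of_mem _ h.mem.2.2]
    exact EReal.coe_lt_top _
  · by_cases hTm : T ∈ sys.powerSet
    · rw [theta4_of_mem _ h.mem.2.2, theta4_of_mem _ hTm, ← EReal.coe_add, EReal.coe_le_coe_iff,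
        ← reInner_opS]
      linarith [h.varT T hTm, half_frobSq_add_le hT z.T T]
    · rw [theta4_of_notMem _ hTm]
      exact le_top

/-- Adding the conditions of the four blocks produces exactly the multiplier terms of the Lagrangian
at `z'`; at `z` these vanish by feasibility. -/
theorem lagrangian_le (h : Optimality etaW etaT z L) (hW : 0 ≤ etaW) (hT : 0 ≤ etaT)
    (z' : sys.Primal) :
    sys.augLagrangian etaW etaT 0 z L ≤ sys.augLagrangian etaW etaT 0 z' L := by
  unfold augLagrangian
  by_cases hz : z'.InSets
  · rw [objective_of_inSets _ _ h.mem, objective_of_inSets _ _ hz, ← EReal.coe_add,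
      ← EReal.coe_add, EReal.coe_le_coe_iff, coupling_of_linFeasible h.linFeasible, coupling_zero]
    have h1 := h.varQ _ hz.1
    have h2 := h.varX _ hz.2.1
    have h3 := h.varW (z'.W - z.W)
    have h4 := h.varT _ hz.2.2
    have h5 := half_frobSq_add_le hW z.W z'.W
    have h6 := half_frobSq_add_le hT z.T z'.T
    rw [h.eqQ] at h1
    rw [h.eqX] at h2
    have h7 : reInner L.w z.W = reInner L.w (sys.opS z.T) := congrArg _ h.eqW
    simp only [reInner_sub_right, opA_sub, opF_sub, opS_sub] at h1 h2 h3 h4 h5 h6 ⊢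
    linarith
  · rw [objective_of_not_inSets _ _ hz, EReal.top_add_coe]
    exact le_top

theorem isPrimalDualSolution (h : Optimality etaW etaT z L) (hW : 0 ≤ etaW) (hT : 0 ≤ etaT) :
    sys.IsPrimalDualSolution etaW etaT z L := by
  refine ⟨(objective_lt_top_iff _ _).2 h.mem, fun L' => ?_, h.lagrangian_le hW hT⟩
  rw [augLagrangian, augLagrangian, coupling_of_linFeasible h.linFeasible,
    coupling_of_linFeasible h.linFeasible]

theorem isGlobalSolution (h : Optimality etaW etaT z L) (hW : 0 ≤ etaW) (hT : 0 ≤ etaT) :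
    sys.IsGlobalSolution etaW etaT z := by
  refine ⟨h.linFeasible, (objective_lt_top_iff _ _).2 h.mem, fun z' hz' => ?_⟩
  have := h.lagrangian_le hW hT z'
  rwa [augLagrangian, augLagrangian, coupling_of_linFeasible h.linFeasible,
    coupling_of_linFeasible hz', EReal.coe_zero, add_zero, add_zero] at this

end Optimality

/-- Everything is a function of `T` on the feasible set. The reduced problem has a minimizer by
coercivity; duality for its mask and clipping constraints provides the first two multipliers, and
the `W` equation then dictates the third. -/
theorem exists_optimality (hr : ∀ j, 0 < sys.r j) (hchi : 0 < sys.chi) (hP : ∀ s, 0 < sys.P s)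
    {etaW etaT : ℝ} (hW : 0 < etaW) (hT : 0 < etaT) :
    ∃ (z : sys.Primal) (L : sys.Dual), Optimality etaW etaT z L := by
  let g : sys.TMat → ℝ := fun T =>
    sys.fit T + (etaT / 2 * frobSq T + etaW / 2 * frobSq (sys.opS T))
  have hg : Continuous g := sys.continuous_fit.add ((continuous_const.mul continuous_frobSq).add
    (continuous_const.mul (continuous_frobSq.comp sys.continuous_opS)))
  have hgc : ConvexOn ℝ sys.powerSet g := by
    refine ConvexOn.subset ?_ (Set.subset_univ _) sys.convex_powerSet
    exact sys.convexOn_fit.add ((convexOn_frobSq.smul (half_pos hT).le).add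
      ((convexOn_frobSq.comp_linearMap sys.opSLin).smul (half_pos hW).le))
  let B : sys.TMat →ₗ[ℝ] sys.QMat × sys.XMat :=
    (sys.opALin ∘ₗ sys.opSLin).prod (sys.opFLin ∘ₗ sys.opSLin)
  have hB : ∀ T, B T = (sys.opA (sys.opS T), sys.opF (sys.opS T)) := fun T => rfl
  have hclosed : IsClosed (sys.powerSet ∩ ((fun T => sys.opA (sys.opS T)) ⁻¹' sys.maskSet ∩
      (fun T => sys.opF (sys.opS T)) ⁻¹' sys.clipSet)) :=
    sys.isClosed_powerSet.inter
      ((sys.isClosed_maskSet.preimage (sys.continuous_opA.comp sys.continuous_opS)).inter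
        (sys.isClosed_clipSet.preimage (sys.continuous_opF.comp sys.continuous_opS)))
  obtain ⟨T, ⟨hTP, hTM, hTC⟩, hmin⟩ := exists_isMin_of_coercive hclosed
    ⟨0, sys.zero_mem_powerSet hP, by simpa using sys.zero_mem_maskSet hr,
      by simpa using sys.zero_mem_clipSet hchi⟩ hg (half_pos hT) (k := 0) fun T => by
    have := sys.fit_nonneg T
    have := mul_nonneg (half_pos hW).le (frobSq_nonneg (sys.opS T))
    simp only [g]
    linarith
  obtain ⟨f, hf⟩ := exists_multiplier (C₁ := sys.maskSet ×ˢ sys.clipSet) (μ := g T)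
    (sys.convex_maskSet.prod sys.convex_clipSet)
    (by
      rw [interior_prod_eq]
      exact ⟨sys.zero_mem_interior_maskSet hr, sys.zero_mem_interior_clipSet hchi⟩)
    (sys.zero_mem_powerSet hP) hgc B
    (fun T' hT' hBT' => hmin T' ⟨hT', hBT'.1, hBT'.2⟩)
  obtain ⟨Lq, hLq⟩ := exists_reInner_eq (f.toLinearMap ∘ₗ LinearMap.inl ℝ sys.QMat sys.XMat)
  obtain ⟨Lx, hLx⟩ := exists_reInner_eq (f.toLinearMap ∘ₗ LinearMap.inr ℝ sys.QMat sys.XMat)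
  have key : ∀ T' ∈ sys.powerSet, ∀ Q ∈ sys.maskSet, ∀ X ∈ sys.clipSet,
      g T ≤ g T' + (reInner Lq (Q - sys.opA (sys.opS T'))
        + reInner Lx (X - sys.opF (sys.opS T'))) := fun T' hT' Q hQ X hX => by
    have h := hf T' hT' (Q, X) ⟨hQ, hX⟩
    rw [← hLq, ← hLx]
    simp only [LinearMap.comp_apply, LinearMap.inl_apply, LinearMap.inr_apply]
    rw [← map_add]
    simpa [hB] using h
  -- The third multiplier is the adjoint image of the first two minus the gradient of the `W`
  -- regularization, that is, the solution of the stationarity equation in `W`.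
  have hLw : ∀ V : sys.WMat,
      reInner (Lq * sys.maskMatᴴᵀ + Lx * sys.idftᴴᵀ - etaW • sys.opS T) V
        = reInner Lq (sys.opA V) + reInner Lx (sys.opF V) - etaW * reInner (sys.opS T) V :=
    fun V => by
      rw [reInner_sub_left, reInner_add_left, reInner_smul_left, reInner_opA, reInner_opF]
  refine ⟨⟨sys.opA (sys.opS T), sys.opF (sys.opS T), sys.opS T, T⟩,
    ⟨Lq, Lx, Lq * sys.maskMatᴴᵀ + Lx * sys.idftᴴᵀ - etaW • sys.opS T⟩,
    rfl, rfl, rfl, ⟨hTM, hTC, hTP⟩, fun Q hQ => ?_, fun X hX => ?_, fun V => ?_, fun T' hT' => ?_⟩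
  · have := key T hTP Q hQ _ hTC
    simp only [sub_self, reInner_zero_right] at this ⊢
    linarith
  · have := key T hTP _ hTM X hX
    simp only [sub_self, reInner_zero_right] at this ⊢
    linarith
  · simp only [hLw]
    ring
  -- By `key` at Q = 𝔄𝔖T and X = 𝔉𝔖T, the point `T` minimizes the reduced Lagrangian over the power
  -- set. Its terms through 𝔖 have derivative −⟨Λ_w, 𝔖·⟩.
  · refine (variational_of_isMin (C := sys.powerSet) (N := sys.fit)
      (q := fun T' => etaT / 2 * frobSq T' + etaW / 2 * frobSq (sys.opS T')
        - reInner Lq (sys.opA (sys.opS T')) - reInner Lx (sys.opF (sys.opS T')))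
      (D := fun d => etaT * reInner T d + etaW * reInner (sys.opS T) (sys.opS d)
        - reInner Lq (sys.opA (sys.opS d)) - reInner Lx (sys.opF (sys.opS d)))
      (R := fun d => etaT / 2 * frobSq d + etaW / 2 * frobSq (sys.opS d))
      (sys.convexOn_fit.subset (Set.subset_univ _) sys.convex_powerSet) (fun d t => ?_) hTP
      (fun T' hT' => ?_) hT').trans (le_of_eq ?_)
    · simp only [opS_add, opS_smul, opA_add, opA_smul, opF_add, opF_smul, frobSq_add_smul,
        reInner_add_right, reInner_smul_right]
      ring
    · have := key T' hT' _ hTM _ hTC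
      simp only [g, reInner_sub_right] at this
      linarith
    · simp only [hLw]
      ring

/-! ### The Lyapunov function of the ADMM -/

/-- The Lyapunov function of the ADMM relative to a primal-dual solution. -/
noncomputable def lyapunov (rho : ℝ) (zs : sys.Primal) (Ls : sys.Dual) (z : sys.Primal)
    (L : sys.Dual) : ℝ :=
  (frobSq (L.q - Ls.q) / (2 * rho) + rho / 2 * frobSq (sys.opA (z.W - zs.W)))
    + (frobSq (L.x - Ls.x) / (2 * rho) + rho / 2 * frobSq (sys.opF (z.W - zs.W)))
    + (frobSq (L.w - Ls.w) / (2 * rho) + rho / 2 * frobSq (sys.opS (z.T - zs.T)))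

/-- Sum of `lyapunov_identity` over the three constraints, applied to errors relative to the saddle
point. `bW` makes the new-multiplier terms of the first two constraints cancel against the `W` term
of the third, leaving the strong convexity gains. -/
theorem lyapunov_step {etaW etaT rho : ℝ} (hrho : 0 < rho) {zs z z' : sys.Primal}
    {Ls L L' : sys.Dual} (h : Optimality etaW etaT zs Ls)
    (hs : StepOptimality etaW etaT rho z L z' L') :
    rho / 2 * frobSq (z'.Q - sys.opA z.W) + rho / 2 * frobSq (z'.X - sys.opF z.W)
      + etaW * frobSq (z'.W - zs.W) + etaT * frobSq (z'.T - zs.T)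
      ≤ lyapunov rho zs Ls z L - lyapunov rho zs Ls z' L' := by
  have eQ : ∀ W, (z'.Q - zs.Q) - sys.opA (W - zs.W) = z'.Q - sys.opA W := fun W => by
    rw [h.eqQ, opA_sub]; abel
  have eX : ∀ W, (z'.X - zs.X) - sys.opF (W - zs.W) = z'.X - sys.opF W := fun W => by
    rw [h.eqX, opF_sub]; abel
  have eW : ∀ T, (z'.W - zs.W) - sys.opS (T - zs.T) = z'.W - sys.opS T := fun T => by
    rw [opS_sub, ← h.eqW]; abel
  have iq := lyapunov_identity hrho.ne' (L.q - Ls.q) (z'.Q - zs.Q) (sys.opA (z.W - zs.W))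
    (sys.opA (z'.W - zs.W))
  have ix := lyapunov_identity hrho.ne' (L.x - Ls.x) (z'.X - zs.X) (sys.opF (z.W - zs.W))
    (sys.opF (z'.W - zs.W))
  have iw := lyapunov_identity hrho.ne' (L.w - Ls.w) (z'.W - zs.W) (sys.opS (z.T - zs.T))
    (sys.opS (z'.T - zs.T))
  have dq : L.q - Ls.q + rho • (z'.Q - sys.opA z'.W) = L'.q - Ls.q := by rw [hs.dualq]; abel
  have dx : L.x - Ls.x + rho • (z'.X - sys.opF z'.W) = L'.x - Ls.x := by rw [hs.dualx]; abel
  have dw : L.w - Ls.w + rho • (z'.W - sys.opS z'.T) = L'.w - Ls.w := by rw [hs.dualw]; abel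
  rw [eQ, eQ, dq] at iq
  rw [eX, eX, dx] at ix
  rw [eW, eW, dw] at iw
  -- This residual term is also part of the decrease, but it is not needed and is dropped.
  have hw := mul_nonneg (half_pos hrho).le (frobSq_nonneg (z'.W - sys.opS z.T))
  -- Monotonicity of the normal cone: each of the two points is tested in the other's variational
  -- inequality.
  have bQ : reInner (L.q - Ls.q + rho • (z'.Q - sys.opA z.W)) (z'.Q - zs.Q) ≤ 0 := by
    have h1 := h.varQ _ hs.mem.1
    have h2 := hs.varQ _ h.mem.1
    rw [← neg_sub z'.Q zs.Q, reInner_neg_right, reInner_add_left] at h2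
    rw [reInner_add_left, reInner_sub_left]
    linarith
  have bX : reInner (L.x - Ls.x + rho • (z'.X - sys.opF z.W)) (z'.X - zs.X) ≤ 0 := by
    have h1 := h.varX _ hs.mem.2.1
    have h2 := hs.varX _ h.mem.2.1
    rw [← neg_sub z'.X zs.X, reInner_neg_right, reInner_add_left] at h2
    rw [reInner_add_left, reInner_sub_left]
    linarith
  have bW : etaW * frobSq (z'.W - zs.W)
      + reInner (L.w - Ls.w + rho • (z'.W - sys.opS z.T)) (z'.W - zs.W)
      = reInner (L'.q - Ls.q) (sys.opA (z'.W - zs.W))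
        + reInner (L'.x - Ls.x) (sys.opF (z'.W - zs.W)) := by
    have h1 := h.varW (z'.W - zs.W)
    have h2 := hs.varW (z'.W - zs.W)
    rw [reInner_add_left] at h2
    rw [← reInner_self, reInner_sub_left z'.W, reInner_add_left, reInner_sub_left L.w,
      reInner_sub_left L'.q, reInner_sub_left L'.x]
    linarith
  have bT : etaT * frobSq (z'.T - zs.T) ≤ reInner (L'.w - Ls.w) (sys.opS (z'.T - zs.T)) := by
    have h1 := h.varT _ hs.mem.2.2
    have h2 := hs.varT _ h.mem.2.2
    have e : sys.opS (zs.T - z'.T) = -sys.opS (z'.T - zs.T) := by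
      rw [opS_sub, opS_sub]; abel
    rw [e, ← neg_sub z'.T zs.T, reInner_neg_right, reInner_neg_right] at h2
    rw [← reInner_self, reInner_sub_left z'.T, reInner_sub_left L'.w]
    linarith
  unfold lyapunov
  linarith

theorem lyapunov_nonneg {rho : ℝ} (hrho : 0 < rho) (zs : sys.Primal) (Ls : sys.Dual)
    (z : sys.Primal) (L : sys.Dual) : 0 ≤ lyapunov rho zs Ls z L := by
  unfold lyapunov
  have := frobSq_nonneg (L.q - Ls.q)
  have := frobSq_nonneg (L.x - Ls.x)
  have := frobSq_nonneg (L.w - Ls.w)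
  have := frobSq_nonneg (sys.opA (z.W - zs.W))
  have := frobSq_nonneg (sys.opF (z.W - zs.W))
  have := frobSq_nonneg (sys.opS (z.T - zs.T))
  positivity

theorem frobSq_dual_le {rho : ℝ} (hrho : 0 < rho) (zs : sys.Primal) (Ls : sys.Dual)
    (z : sys.Primal) (L : sys.Dual) :
    frobSq (L.q - Ls.q) ≤ 2 * rho * lyapunov rho zs Ls z L ∧
    frobSq (L.x - Ls.x) ≤ 2 * rho * lyapunov rho zs Ls z L ∧
    frobSq (L.w - Ls.w) ≤ 2 * rho * lyapunov rho zs Ls z L := by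
  have hq := div_nonneg (frobSq_nonneg (L.q - Ls.q)) (by positivity : 0 ≤ 2 * rho)
  have hx := div_nonneg (frobSq_nonneg (L.x - Ls.x)) (by positivity : 0 ≤ 2 * rho)
  have hw := div_nonneg (frobSq_nonneg (L.w - Ls.w)) (by positivity : 0 ≤ 2 * rho)
  have h4 := mul_nonneg (half_pos hrho).le (frobSq_nonneg (sys.opA (z.W - zs.W)))
  have h5 := mul_nonneg (half_pos hrho).le (frobSq_nonneg (sys.opF (z.W - zs.W)))
  have h6 := mul_nonneg (half_pos hrho).le (frobSq_nonneg (sys.opS (z.T - zs.T)))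
  unfold lyapunov
  refine ⟨?_, ?_, ?_⟩ <;>
  · rw [← div_le_iff₀' (by positivity)]
    linarith

/-! ### Convergence of the ADMM -/

section Convergence

variable {etaW etaT rho : ℝ} {z : ℕ → sys.Primal} {L : ℕ → sys.Dual}

theorem antitone_lyapunov (hW : 0 < etaW) (hT : 0 < etaT) (hrho : 0 < rho)
    {zs : sys.Primal} {Ls : sys.Dual} (h : Optimality etaW etaT zs Ls)
    (hs : ∀ τ, StepOptimality etaW etaT rho (z τ) (L τ) (z (τ + 1)) (L (τ + 1))) :
    Antitone fun τ => lyapunov rho zs Ls (z τ) (L τ) := by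
  refine antitone_nat_of_succ_le fun τ => ?_
  have h1 := lyapunov_step hrho h (hs τ)
  have h2 := mul_nonneg (half_pos hrho).le (frobSq_nonneg ((z (τ + 1)).Q - sys.opA (z τ).W))
  have h3 := mul_nonneg (half_pos hrho).le (frobSq_nonneg ((z (τ + 1)).X - sys.opF (z τ).W))
  have h4 := mul_nonneg hW.le (frobSq_nonneg ((z (τ + 1)).W - zs.W))
  have h5 := mul_nonneg hT.le (frobSq_nonneg ((z (τ + 1)).T - zs.T))
  linarith

theorem tendsto_zero_of_mul_le {c : ℝ} (hc : 0 < c) {f g : ℕ → ℝ} (hf : ∀ τ, 0 ≤ f τ)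
    (hfg : ∀ τ, c * f τ ≤ g τ) (hg : Tendsto g atTop (𝓝 0)) : Tendsto f atTop (𝓝 0) := by
  have h := hg.const_mul c⁻¹
  rw [mul_zero] at h
  exact squeeze_zero hf (fun τ => by rw [← div_eq_inv_mul, le_div_iff₀' hc]; exact hfg τ) h

/-- The primal iterates converge to any primal solution that has multipliers. -/
theorem tendsto_primal (hW : 0 < etaW) (hT : 0 < etaT) (hrho : 0 < rho)
    {zs : sys.Primal} {Ls : sys.Dual} (h : Optimality etaW etaT zs Ls)
    (hs : ∀ τ, StepOptimality etaW etaT rho (z τ) (L τ) (z (τ + 1)) (L (τ + 1))) :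
    Tendsto (fun τ => (z τ).Q) atTop (𝓝 zs.Q) ∧ Tendsto (fun τ => (z τ).X) atTop (𝓝 zs.X) ∧
      Tendsto (fun τ => (z τ).W) atTop (𝓝 zs.W) ∧ Tendsto (fun τ => (z τ).T) atTop (𝓝 zs.T) := by
  -- A monotone sequence bounded below converges, so its consecutive differences, which dominate all
  -- the terms below, tend to 0.
  have hdiff : Tendsto (fun τ => lyapunov rho zs Ls (z τ) (L τ)
      - lyapunov rho zs Ls (z (τ + 1)) (L (τ + 1))) atTop (𝓝 0) := by
    have hlim := tendsto_atTop_ciInf (antitone_lyapunov hW hT hrho h hs)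
      ⟨0, by rintro _ ⟨τ, rfl⟩; exact lyapunov_nonneg hrho _ _ _ _⟩
    simpa using hlim.sub ((tendsto_add_atTop_iff_nat 1).2 hlim)
  have h0 : ∀ τ, 0 ≤ rho / 2 * frobSq ((z (τ + 1)).Q - sys.opA (z τ).W) := fun τ =>
    mul_nonneg (half_pos hrho).le (frobSq_nonneg _)
  have h1 : ∀ τ, 0 ≤ rho / 2 * frobSq ((z (τ + 1)).X - sys.opF (z τ).W) := fun τ =>
    mul_nonneg (half_pos hrho).le (frobSq_nonneg _)
  have h2 : ∀ τ, 0 ≤ etaW * frobSq ((z (τ + 1)).W - zs.W) := fun τ =>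
    mul_nonneg hW.le (frobSq_nonneg _)
  have h3 : ∀ τ, 0 ≤ etaT * frobSq ((z (τ + 1)).T - zs.T) := fun τ =>
    mul_nonneg hT.le (frobSq_nonneg _)
  have hstep := fun τ => lyapunov_step hrho h (hs τ)
  have tW : Tendsto (fun τ => (z τ).W) atTop (𝓝 zs.W) :=
    (tendsto_add_atTop_iff_nat 1).1 (tendsto_of_frobSq_sub (tendsto_zero_of_mul_le hW
      (fun τ => frobSq_nonneg _)
      (fun τ => by linarith [hstep τ, h0 τ, h1 τ, h2 τ, h3 τ]) hdiff))
  have tT : Tendsto (fun τ => (z τ).T) atTop (𝓝 zs.T) :=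
    (tendsto_add_atTop_iff_nat 1).1 (tendsto_of_frobSq_sub (tendsto_zero_of_mul_le hT
      (fun τ => frobSq_nonneg _)
      (fun τ => by linarith [hstep τ, h0 τ, h1 τ, h2 τ, h3 τ]) hdiff))
  -- `Q` and `X` have no strongly convex term; they are recovered from vanishing residuals and the
  -- convergence of `W`.
  have tQ : Tendsto (fun τ => (z (τ + 1)).Q - sys.opA (z τ).W) atTop (𝓝 0) := by
    refine tendsto_of_frobSq_sub ?_
    simp only [sub_zero]
    exact tendsto_zero_of_mul_le (half_pos hrho) (fun τ => frobSq_nonneg _)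
      (fun τ => by linarith [hstep τ, h0 τ, h1 τ, h2 τ, h3 τ]) hdiff
  have tX : Tendsto (fun τ => (z (τ + 1)).X - sys.opF (z τ).W) atTop (𝓝 0) := by
    refine tendsto_of_frobSq_sub ?_
    simp only [sub_zero]
    exact tendsto_zero_of_mul_le (half_pos hrho) (fun τ => frobSq_nonneg _)
      (fun τ => by linarith [hstep τ, h0 τ, h1 τ, h2 τ, h3 τ]) hdiff
  refine ⟨(tendsto_add_atTop_iff_nat 1).1 ?_, (tendsto_add_atTop_iff_nat 1).1 ?_, tW, tT⟩
  · have := tQ.add ((sys.continuous_opA.tendsto zs.W).comp tW)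
    simpa [h.eqQ, Function.comp_def] using this
  · have := tX.add ((sys.continuous_opF.tendsto zs.W).comp tW)
    simpa [h.eqX, Function.comp_def] using this

/-- One ultrafilter serves all three multiplier sequences, replacing successive extraction of
subsequences. -/
theorem exists_tendsto_ultrafilter {m n : ℕ} (U : Ultrafilter ℕ)
    {f : ℕ → Matrix (Fin m) (Fin n) ℂ} {A : Matrix (Fin m) (Fin n) ℂ} {R : ℝ}
    (hf : ∀ τ, frobSq (f τ - A) ≤ R) : ∃ B, Tendsto f U (𝓝 B) := by
  obtain ⟨B, -, hB⟩ := (isCompact_setOf_frobSq_le (m := m) (n := n) R).ultrafilter_le_nhds'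
    (U.map fun τ => f τ - A)
    (Ultrafilter.mem_map.2 (Filter.univ_mem' hf))
  refine ⟨B + A, ?_⟩
  have h : Tendsto (fun τ => f τ - A) U (𝓝 B) := hB
  simpa using h.add_const A

/-- A limit of the multipliers along an ultrafilter is a multiplier of the limit problem. -/
theorem optimality_of_tendsto {U : Filter ℕ} [U.NeBot]
    {zs : sys.Primal} {Ls Lu : sys.Dual} (h : Optimality etaW etaT zs Ls)
    (hs : ∀ τ, StepOptimality etaW etaT rho (z τ) (L τ) (z (τ + 1)) (L (τ + 1)))
    (tQ' : Tendsto (fun τ => (z (τ + 1)).Q) U (𝓝 zs.Q))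
    (tX' : Tendsto (fun τ => (z (τ + 1)).X) U (𝓝 zs.X))
    (tW : Tendsto (fun τ => (z τ).W) U (𝓝 zs.W))
    (tW' : Tendsto (fun τ => (z (τ + 1)).W) U (𝓝 zs.W))
    (tT : Tendsto (fun τ => (z τ).T) U (𝓝 zs.T))
    (tT' : Tendsto (fun τ => (z (τ + 1)).T) U (𝓝 zs.T))
    (tq : Tendsto (fun τ => (L τ).q) U (𝓝 Lu.q)) (tx : Tendsto (fun τ => (L τ).x) U (𝓝 Lu.x))
    (tw : Tendsto (fun τ => (L τ).w) U (𝓝 Lu.w)) : Optimality etaW etaT zs Lu := by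
  have tA := (sys.continuous_opA.tendsto zs.W).comp tW
  have tA' := (sys.continuous_opA.tendsto zs.W).comp tW'
  have tF := (sys.continuous_opF.tendsto zs.W).comp tW
  have tF' := (sys.continuous_opF.tendsto zs.W).comp tW'
  have tS := (sys.continuous_opS.tendsto zs.T).comp tT
  have tS' := (sys.continuous_opS.tendsto zs.T).comp tT'
  have eQ : zs.Q - sys.opA zs.W = 0 := sub_eq_zero.2 h.eqQ
  have eX : zs.X - sys.opF zs.W = 0 := sub_eq_zero.2 h.eqX
  have eW : zs.W - sys.opS zs.T = 0 := sub_eq_zero.2 h.eqW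
  -- The intermediate multipliers differ from the old ones by a vanishing residual.
  have mq : Tendsto (fun τ => (L τ).q + rho • ((z (τ + 1)).Q - sys.opA (z τ).W)) U (𝓝 Lu.q) := by
    simpa [eQ] using tq.add ((tQ'.sub tA).const_smul rho)
  have mx : Tendsto (fun τ => (L τ).x + rho • ((z (τ + 1)).X - sys.opF (z τ).W)) U (𝓝 Lu.x) := by
    simpa [eX] using tx.add ((tX'.sub tF).const_smul rho)
  have mw : Tendsto (fun τ => (L τ).w + rho • ((z (τ + 1)).W - sys.opS (z τ).T)) U (𝓝 Lu.w) := by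
    simpa [eW] using tw.add ((tW'.sub tS).const_smul rho)
  -- Convergence along `U` is not shift invariant; that the shifted multipliers have the same limit
  -- comes from the dual update and the vanishing residual.
  have tq' : Tendsto (fun τ => (L (τ + 1)).q) U (𝓝 Lu.q) := by
    simp only [fun τ => (hs τ).dualq]
    simpa [eQ] using tq.add ((tQ'.sub tA').const_smul rho)
  have tx' : Tendsto (fun τ => (L (τ + 1)).x) U (𝓝 Lu.x) := by
    simp only [fun τ => (hs τ).dualx]
    simpa [eX] using tx.add ((tX'.sub tF').const_smul rho)
  have tw' : Tendsto (fun τ => (L (τ + 1)).w) U (𝓝 Lu.w) := by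
    simp only [fun τ => (hs τ).dualw]
    simpa [eW] using tw.add ((tW'.sub tS').const_smul rho)
  refine ⟨h.eqQ, h.eqX, h.eqW, h.mem, fun Q hQ => ?_, fun X hX => ?_, fun V => ?_, fun T hT => ?_⟩
  · exact ge_of_tendsto' (tendsto_reInner mq (tQ'.const_sub Q)) fun τ => (hs τ).varQ Q hQ
  · exact ge_of_tendsto' (tendsto_reInner mx (tX'.const_sub X)) fun τ => (hs τ).varX X hX
  · refine tendsto_nhds_unique
      (((tendsto_reInner tW' tendsto_const_nhds).const_mul etaW).add
        (tendsto_reInner mw tendsto_const_nhds)) ?_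
    simp only [fun τ => (hs τ).varW V]
    exact (tendsto_reInner tq' tendsto_const_nhds).add (tendsto_reInner tx' tendsto_const_nhds)
  · have tD := tT'.const_sub T
    exact le_of_tendsto_of_tendsto' ((sys.continuous_fit.tendsto zs.T).comp tT')
      (tendsto_const_nhds.add (((tendsto_reInner tT' tD).const_mul etaT).sub
        (tendsto_reInner tw' ((sys.continuous_opS.tendsto _).comp tD))))
      fun τ => (hs τ).varT T hT

theorem exists_limit (hr : ∀ j, 0 < sys.r j) (hchi : 0 < sys.chi) (hP : ∀ s, 0 < sys.P s)
    (hW : 0 < etaW) (hT : 0 < etaT) (hrho : 0 < rho)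
    (hs : ∀ τ, StepOptimality etaW etaT rho (z τ) (L τ) (z (τ + 1)) (L (τ + 1))) :
    ∃ (zs : sys.Primal) (Ls : sys.Dual),
      Tendsto (fun τ => (z τ).Q) atTop (𝓝 zs.Q) ∧ Tendsto (fun τ => (z τ).X) atTop (𝓝 zs.X) ∧
      Tendsto (fun τ => (z τ).W) atTop (𝓝 zs.W) ∧ Tendsto (fun τ => (z τ).T) atTop (𝓝 zs.T) ∧
      Tendsto (fun τ => (L τ).q) atTop (𝓝 Ls.q) ∧ Tendsto (fun τ => (L τ).x) atTop (𝓝 Ls.x) ∧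
      Tendsto (fun τ => (L τ).w) atTop (𝓝 Ls.w) ∧ Optimality etaW etaT zs Ls := by
  obtain ⟨zs, L₁, h₁⟩ := exists_optimality hr hchi hP hW hT
  obtain ⟨tQ, tX, tW, tT⟩ := tendsto_primal hW hT hrho h₁ hs
  have hle : ∀ τ, 2 * rho * lyapunov rho zs L₁ (z τ) (L τ)
      ≤ 2 * rho * lyapunov rho zs L₁ (z 0) (L 0) := fun τ =>
    mul_le_mul_of_nonneg_left (antitone_lyapunov hW hT hrho h₁ hs (Nat.zero_le τ)) (by positivity)
  have hb := fun τ => frobSq_dual_le hrho zs L₁ (z τ) (L τ)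
  let U : Ultrafilter ℕ := Filter.hyperfilter ℕ
  have hU : (U : Filter ℕ) ≤ atTop := Nat.hyperfilter_le_atTop
  obtain ⟨q, hq⟩ := exists_tendsto_ultrafilter U fun τ => (hb τ).1.trans (hle τ)
  obtain ⟨x, hx⟩ := exists_tendsto_ultrafilter U fun τ => (hb τ).2.1.trans (hle τ)
  obtain ⟨w, hw⟩ := exists_tendsto_ultrafilter U fun τ => (hb τ).2.2.trans (hle τ)
  -- The multipliers `L₁` are now replaced by those reached along `U`, and the Lyapunov function is
  -- recentred there.
  have h : Optimality etaW etaT zs ⟨q, x, w⟩ := optimality_of_tendsto (U := U) h₁ hs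
    (((tendsto_add_atTop_iff_nat 1).2 tQ).mono_left hU)
    (((tendsto_add_atTop_iff_nat 1).2 tX).mono_left hU)
    (tW.mono_left hU) (((tendsto_add_atTop_iff_nat 1).2 tW).mono_left hU)
    (tT.mono_left hU) (((tendsto_add_atTop_iff_nat 1).2 tT).mono_left hU) hq hx hw
  have hlim := tendsto_atTop_ciInf (antitone_lyapunov hW hT hrho h hs)
    ⟨0, by rintro _ ⟨τ, rfl⟩; exact lyapunov_nonneg hrho _ _ _ _⟩
  have hUlim : Tendsto (fun τ => lyapunov rho zs ⟨q, x, w⟩ (z τ) (L τ)) U (𝓝 0) := by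
    have dist : ∀ {m n : ℕ} {f : ℕ → Matrix (Fin m) (Fin n) ℂ} {A : Matrix (Fin m) (Fin n) ℂ},
        Tendsto f U (𝓝 A) → Tendsto (fun τ => frobSq (f τ - A)) U (𝓝 0) := fun {m n f A} hf => by
      have := (continuous_frobSq.tendsto (A - A)).comp (hf.sub_const A)
      simpa [Function.comp_def] using this
    have oA := (continuous_frobSq.tendsto _).comp
      ((sys.continuous_opA.tendsto _).comp ((tW.mono_left hU).sub_const zs.W))
    have oF := (continuous_frobSq.tendsto _).comp
      ((sys.continuous_opF.tendsto _).comp ((tW.mono_left hU).sub_const zs.W))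
    have oS := (continuous_frobSq.tendsto _).comp
      ((sys.continuous_opS.tendsto _).comp ((tT.mono_left hU).sub_const zs.T))
    have := ((((dist hq).div_const (2 * rho)).add (oA.const_mul (rho / 2))).add
      (((dist hx).div_const (2 * rho)).add (oF.const_mul (rho / 2)))).add
      (((dist hw).div_const (2 * rho)).add (oS.const_mul (rho / 2)))
    simpa [lyapunov] using this
  -- The recentred function converges along `atTop` by monotonicity; its value along the finer `U`
  -- identifies the limit as 0.
  rw [tendsto_nhds_unique (hlim.mono_left hU) hUlim] at hlim
  have hlim2 := hlim.const_mul (2 * rho)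
  rw [mul_zero] at hlim2
  have hb' := fun τ => frobSq_dual_le hrho zs ⟨q, x, w⟩ (z τ) (L τ)
  exact ⟨zs, ⟨q, x, w⟩, tQ, tX, tW, tT,
    tendsto_of_frobSq_sub (squeeze_zero (fun _ => frobSq_nonneg _) (fun τ => (hb' τ).1) hlim2),
    tendsto_of_frobSq_sub (squeeze_zero (fun _ => frobSq_nonneg _) (fun τ => (hb' τ).2.1) hlim2),
    tendsto_of_frobSq_sub (squeeze_zero (fun _ => frobSq_nonneg _) (fun τ => (hb' τ).2.2) hlim2),
    h⟩

end Convergence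

/-! ### Vanishing regularization -/

/-- Feasibility passes to the limit by closedness and continuity. For a fixed feasible competitor
the regularization terms vanish in the limit, while those of the solutions are nonnegative and can
be discarded beforehand. -/
theorem isGlobalSolution_of_mapClusterPt {etaW etaT : ℕ → ℝ} (hW : ∀ ν, 0 < etaW ν)
    (hT : ∀ ν, 0 < etaT ν) (tW : Tendsto etaW atTop (𝓝 0)) (tT : Tendsto etaT atTop (𝓝 0))
    {z : ℕ → sys.Primal} (hz : ∀ ν, sys.IsGlobalSolution (etaW ν) (etaT ν) (z ν))
    {zbar : sys.Primal} (hbar : MapClusterPt (zbar.Q, zbar.X, zbar.W, zbar.T) atTop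
      (fun ν => ((z ν).Q, (z ν).X, (z ν).W, (z ν).T))) : sys.IsGlobalSolution 0 0 zbar := by
  obtain ⟨U, hU, hlim⟩ := mapClusterPt_iff_ultrafilter.1 hbar
  have lQ : Tendsto (fun ν => (z ν).Q) U (𝓝 zbar.Q) := (continuous_fst.tendsto _).comp hlim
  have lXWT := (continuous_snd.tendsto _).comp hlim
  have lX : Tendsto (fun ν => (z ν).X) U (𝓝 zbar.X) := (continuous_fst.tendsto _).comp lXWT
  have lWT := (continuous_snd.tendsto _).comp lXWT
  have lW : Tendsto (fun ν => (z ν).W) U (𝓝 zbar.W) := (continuous_fst.tendsto _).comp lWT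
  have lT : Tendsto (fun ν => (z ν).T) U (𝓝 zbar.T) := (continuous_snd.tendsto _).comp lWT
  have hin : ∀ ν, (z ν).InSets := fun ν => (objective_lt_top_iff _ _).1 (hz ν).2.1
  have hmem : zbar.InSets :=
    ⟨sys.isClosed_maskSet.mem_of_tendsto lQ (Eventually.of_forall fun ν => (hin ν).1),
      sys.isClosed_clipSet.mem_of_tendsto lX (Eventually.of_forall fun ν => (hin ν).2.1),
      sys.isClosed_powerSet.mem_of_tendsto lT (Eventually.of_forall fun ν => (hin ν).2.2)⟩
  refine ⟨⟨?_, ?_, ?_⟩, (objective_lt_top_iff _ _).2 hmem, fun z' hz' => ?_⟩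
  · refine tendsto_nhds_unique (lQ.sub ((sys.continuous_opA.tendsto _).comp lW)) ?_
    simpa only [Function.comp_apply, fun ν => (hz ν).1.1] using tendsto_const_nhds
  · refine tendsto_nhds_unique (lX.sub ((sys.continuous_opF.tendsto _).comp lW)) ?_
    simpa only [Function.comp_apply, fun ν => (hz ν).1.2.1] using tendsto_const_nhds
  · refine tendsto_nhds_unique (lW.sub ((sys.continuous_opS.tendsto _).comp lT)) ?_
    simpa only [Function.comp_apply, fun ν => (hz ν).1.2.2] using tendsto_const_nhds
  · by_cases hm : z'.InSets
    · rw [objective_of_inSets _ _ hmem, objective_of_inSets _ _ hm, EReal.coe_le_coe_iff]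
      have hle : ∀ ν, sys.fit (z ν).T ≤ etaW ν / 2 * frobSq z'.W
          + (sys.fit z'.T + etaT ν / 2 * frobSq z'.T) := fun ν => by
        have h := (hz ν).2.2 z' hz'
        rw [objective_of_inSets _ _ (hin ν), objective_of_inSets _ _ hm,
          EReal.coe_le_coe_iff] at h
        have h1 := mul_nonneg (half_pos (hW ν)).le (frobSq_nonneg (z ν).W)
        have h2 := mul_nonneg (half_pos (hT ν)).le (frobSq_nonneg (z ν).T)
        linarith
      have := le_of_tendsto_of_tendsto' ((sys.continuous_fit.tendsto _).comp lT)
        ((((tW.mono_left hU).div_const 2).mul_const (frobSq z'.W)).add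
          (tendsto_const_nhds.add (((tT.mono_left hU).div_const 2).mul_const (frobSq z'.T)))) hle
      simpa using this
    · rw [objective_of_not_inSets _ _ hm]
      exact le_top

end HybridSystem

theorem proposition2 (sys : HybridSystem) (hpart : sys.EqualSubarrays)
    (hr : ∀ j, 0 < sys.r j) (hchi : 0 < sys.chi) (hP : ∀ s, 0 < sys.P s) :
    -- realification of the linear operators
    ((∃! AR : Matrix ((Fin sys.G × Fin sys.Nt) ⊕ (Fin sys.G × Fin sys.Nt))
          ((Fin sys.S × Fin sys.Nt) ⊕ (Fin sys.S × Fin sys.Nt)) ℝ,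
        ∀ W, realify (sys.opA W) = AR *ᵥ realify W) ∧
      (∃! FR : Matrix ((Fin (sys.ell * sys.S) × Fin sys.Nt) ⊕ (Fin (sys.ell * sys.S) × Fin sys.Nt))
          ((Fin sys.S × Fin sys.Nt) ⊕ (Fin sys.S × Fin sys.Nt)) ℝ,
        ∀ W, realify (sys.opF W) = FR *ᵥ realify W) ∧
      ∀ T, sys.opS T = sys.selMat ℂ * T ∧
        (sys.opS T).vec = ((1 : Matrix (Fin sys.S) (Fin sys.S) ℂ) ⊗ₖ sys.selMat ℂ) *ᵥ T.vec ∧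
        realify (sys.opS T) =
          Matrix.fromBlocks ((1 : Matrix (Fin sys.S) (Fin sys.S) ℝ) ⊗ₖ sys.selMat ℝ) 0
            0 ((1 : Matrix (Fin sys.S) (Fin sys.S) ℝ) ⊗ₖ sys.selMat ℝ) *ᵥ realify T) ∧
    -- well-posedness and convergence of the ADMM, for every positive penalty parameter
    (∀ etaW etaT rho : ℝ, 0 < etaW → 0 < etaT → 0 < rho →
      (∀ (z₀ : sys.Primal) (L₀ : sys.Dual),
        ∃! u : (ℕ → sys.Primal) × (ℕ → sys.Dual),
          u.1 0 = z₀ ∧ u.2 0 = L₀ ∧ sys.IsADMM etaW etaT rho u.1 u.2) ∧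
      ∀ (z : ℕ → sys.Primal) (L : ℕ → sys.Dual), sys.IsADMM etaW etaT rho z L →
        ∃ (zs : sys.Primal) (Ls : sys.Dual),
          Tendsto (fun τ => (z τ).Q) atTop (𝓝 zs.Q) ∧
          Tendsto (fun τ => (z τ).X) atTop (𝓝 zs.X) ∧
          Tendsto (fun τ => (z τ).W) atTop (𝓝 zs.W) ∧
          Tendsto (fun τ => (z τ).T) atTop (𝓝 zs.T) ∧
          Tendsto (fun τ => (L τ).q) atTop (𝓝 Ls.q) ∧
          Tendsto (fun τ => (L τ).x) atTop (𝓝 Ls.x) ∧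
          Tendsto (fun τ => (L τ).w) atTop (𝓝 Ls.w) ∧
          sys.IsPrimalDualSolution etaW etaT zs Ls ∧
          sys.IsGlobalSolution etaW etaT zs ∧
          sys.IsKKT etaW etaT zs Ls) ∧
    -- vanishing regularization
    (∀ (etaW etaT : ℕ → ℝ), (∀ ν, 0 < etaW ν) → (∀ ν, 0 < etaT ν) →
      Tendsto etaW atTop (𝓝 0) → Tendsto etaT atTop (𝓝 0) →
      ∀ z : ℕ → sys.Primal, (∀ ν, sys.IsGlobalSolution (etaW ν) (etaT ν) (z ν)) →
        ∀ zbar : sys.Primal,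
          MapClusterPt (zbar.Q, zbar.X, zbar.W, zbar.T) atTop
              (fun ν => ((z ν).Q, (z ν).X, (z ν).W, (z ν).T)) →
            sys.IsGlobalSolution 0 0 zbar) := by
  refine ⟨⟨existsUnique_realify_matrix sys.opALin, existsUnique_realify_matrix sys.opFLin,
    fun T => ⟨sys.opS_eq_selMat_mul T, sys.vec_opS T, sys.realify_opS T⟩⟩,
    fun etaW etaT rho hW hT hrho => ⟨fun z₀ L₀ =>
      HybridSystem.existsUnique_isADMM hr hchi hP hW hT hrho z₀ L₀, fun z L hADMM => ?_⟩,
    fun etaW etaT hW hT tW tT z hz zbar hbar =>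
      HybridSystem.isGlobalSolution_of_mapClusterPt hW hT tW tT hz hbar⟩
  obtain ⟨zs, Ls, tQ, tX, tW, tT, tq, tx, tw, h⟩ :=
    HybridSystem.exists_limit hr hchi hP hW hT hrho fun τ => (hADMM τ).stepOptimality
  exact ⟨zs, Ls, tQ, tX, tW, tT, tq, tx, tw, h.isPrimalDualSolution hW.le hT.le,
    h.isGlobalSolution hW.le hT.le, h.isKKT hW.le hT.le⟩
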